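/- Let $H\neq\{0\}$ be a separable real Hilbert space and let $A$ be a strictly positive self-adjoint operator on $H$ whose domain is compactly embedded in $H$; let $\lambda_1>0$ be its first eigenvalue. For $u\in\mathcal D(A^{r/4})$ put $\|u\|_r=\|A^{r/4}u\|$, let $H^2=\mathcal D(A^{1/2})$ with norm $\|\cdot\|_2$, and let $\mathcal H=H^2\times H\times H$ with norm $\|(u,v,\theta)\|_{\mathcal H}^2=\|u\|_2^2+\|v\|^2+\|\theta\|^2$. Let $\beta\in\mathbb R$ and let $f,g\in H$ be independent of time. Suppose that $$\beta>-\sqrt{\lambda_1}\qquad\text{and}\qquad f+g=0 .$$ Then for every $z=(u_0,u_1,\theta_0)\in\mathcal H$ the problem $$\partial_{tt}u+Au-A^{1/2}\theta+(\beta+\|u\|_1^2)A^{1/2}u=f,\qquad \partial_t\theta+A^{1/2}\theta+A^{1/2}\partial_tu=g,$$ with $(u,\partial_tu,\theta)(0)=z$, has exactly one weak solution $(u,\partial_tu,\theta)\in C([0,\infty),\mathcal H)$, the equations being tested with all elements of $H^2$. Write $S(t)z=(u(t),\partial_tu(t),\theta(t))$ and $z_g=(0,0,A^{-1/2}g)\in\mathcal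 H$. The semigroup $S(t)$ has exactly one global attractor $\mathfrak A$ (a compact set with $S(t)\mathfrak A=\mathfrak A$ for all $t\ge0$ and $\boldsymbol\delta_{\mathcal H}(S(t)B,\mathfrak A)\to0$ as $t\to\infty$ for every bounded $B\subset\mathcal H$, where $\boldsymbol\delta_{\mathcal H}(B_1,B_2)=\sup_{b_1\in B_1}\inf_{b_2\in B_2}\|b_1-b_2\|_{\mathcal H}$), namely $$\mathfrak A=\{z_g\}.$$ Moreover there are $\varkappa>0$ and a positive, strictly increasing function $\mathcal Q:[0,\infty)\to(0,\infty)$ such that, for every bounded set $B\subset\mathcal H$ and every $t\ge0$, with $\|B\|_{\mathcal H}=\sup_{z\in B}\|z\|_{\mathcal H}$ (and suprema over the empty set taken to be $0$), $$\boldsymbol\delta_{\mathcal H}(S(t)B,\mathfrak A)=\sup_{z\in B}\|S(t)z-z_g\|_{\mathcal H}\le\mathcal Q(\|B\|_{\mathcal H})\,e^{-\varkappa t}.$$ Both $\varkappa$ and $\mathcal Q$ are explicitly computable, in the following sense: there are two formulas, the same for all $H,A,\beta,f,g$ as above, built from variables and rational constants by sums, products, negatives, inverses, maxima, square roots, $\exp$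 and $\log$, such that $\varkappa$ is the value of the first at $(\beta,\lambda_1)$ and $\mathcal Q(R)$ is the value of the second at $(\beta,\lambda_1,\|g\|,R)$. -/

import Mathlib

open Filter Topology Set
open scoped ENNReal

universe u

namespace ThermoBeam

section Operator

variable {H : Type u} [NormedAddCommGroup H] [InnerProductSpace ℝ H] [CompleteSpace H]

/-- `A` is a strictly positive self-adjoint (in particular densely defined) operator on `H`
whose domain, with the graph norm, is compactly embedded into `H`. -/
structure IsBeamOperator (A : H →ₗ.[ℝ] H) : Prop where
  selfAdjoint : IsSelfAdjoint A
  strictlyPositive : ∃ c : ℝ, 0 < c ∧ ∀ x : A.domain, c * ‖(x : H)‖ ^ 2 ≤ inner ℝ (A x) (x : H)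
  compactEmbedding :
    IsCompact (closure {y : H | ∃ x : A.domain, (x : H) = y ∧ ‖(x : H)‖ ^ 2 + ‖A x‖ ^ 2 ≤ 1})

/-- The space of all `u ∈ D(A)` with `A u = μ u`. -/
def eigenspace (A : H →ₗ.[ℝ] H) (μ : ℝ) : Submodule ℝ H :=
  (LinearMap.ker (A.toFun - μ • A.domain.subtype)).map A.domain.subtype

/-- The smallest eigenvalue of `A`. -/
noncomputable def firstEigenvalue (A : H →ₗ.[ℝ] H) : ℝ :=
  sInf {μ : ℝ | eigenspace A μ ≠ ⊥}

/-- The orthogonal projection of `H` onto the eigenspace of `A` at `μ` (it is zero if `μ` is not an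
eigenvalue). The eigenspaces of a self-adjoint operator are closed, so that taking the closure
changes nothing; it is there to have the projection defined for every `A`. -/
noncomputable def eigenProj (A : H →ₗ.[ℝ] H) (μ : ℝ) : H →L[ℝ] H :=
  (eigenspace A μ).topologicalClosure.starProjection

/-- The domain of the power `A ^ s`, namely all `u` for which the spectral
series `∑ μ ^ s P_μ u`, over the eigenvalues `μ` of `A`, converges in `H`. As the terms are
mutually orthogonal, this says that `∑ μ ^ (2 s) ‖P_μ u‖ ^ 2` is finite. -/
def powDomain (A : H →ₗ.[ℝ] H) (s : ℝ) : Submodule ℝ H where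
  carrier := {u : H | Summable fun μ : ℝ => μ ^ s • eigenProj A μ u}
  zero_mem' := by simp
  add_mem' := by
    intro a b ha hb
    simpa only [Set.mem_ofPred_eq, map_add, smul_add] using Summable.add ha hb
  smul_mem' := by
    intro c a ha
    have h : Summable fun μ : ℝ => c • (μ ^ s • eigenProj A μ a) := Summable.const_smul c ha
    simpa only [Set.mem_ofPred_eq, map_smul, smul_comm c] using h

/-- The power `A ^ s u = ∑ μ ^ s P_μ u`, meaningful for `u ∈ powDomain A s`. -/
noncomputable def opPow (A : H →ₗ.[ℝ] H) (s : ℝ) (u : H) : H :=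
  ∑' μ : ℝ, μ ^ s • eigenProj A μ u

/-- The power `A ^ s` as a linear map on its domain. -/
noncomputable def powMap (A : H →ₗ.[ℝ] H) (s : ℝ) : powDomain A s →ₗ[ℝ] H where
  toFun u := opPow A s u
  map_add' := by
    intro a b
    have h := Summable.tsum_add a.2 b.2
    simpa only [opPow, Submodule.coe_add, map_add, smul_add] using h
  map_smul' := by
    intro c a
    have h : ∑' μ : ℝ, c • (μ ^ s • eigenProj A μ (a : H)) =
        c • ∑' μ : ℝ, μ ^ s • eigenProj A μ (a : H) := Summable.tsum_const_smul c a.2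
    simpa only [opPow, Submodule.coe_smul, map_smul, smul_comm c, RingHom.id_apply] using h

/-- The space `H² = D(A ^ (1/2))`. -/
def SpaceH2 (A : H →ₗ.[ℝ] H) : Type u := powDomain A (1 / 2)

noncomputable instance (A : H →ₗ.[ℝ] H) : AddCommGroup (SpaceH2 A) :=
  inferInstanceAs (AddCommGroup (powDomain A (1 / 2)))

/-- The inclusion of `H²` into `H`. -/
def SpaceH2.val {A : H →ₗ.[ℝ] H} (u : SpaceH2 A) : H := Subtype.val u

/-- The map `A ^ (1/2)` from `H²` to `H`. -/
noncomputable def sqrtMap (A : H →ₗ.[ℝ] H) : SpaceH2 A →+ H := (powMap A (1 / 2)).toAddMonoidHom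

/-- The norm of `H²` is `‖u‖₂ = ‖A ^ (1/2) u‖` (for a strictly positive self-adjoint
operator with compactly embedded domain it is a norm). -/
noncomputable instance (A : H →ₗ.[ℝ] H) : SeminormedAddCommGroup (SpaceH2 A) :=
  SeminormedAddCommGroup.induced (SpaceH2 A) H (sqrtMap A)

/-- The phase space `H² × H × H` with the norm
`(‖A ^ (1/2) u‖ ^ 2 + ‖v‖ ^ 2 + ‖θ‖ ^ 2) ^ (1/2)`. -/
abbrev PhaseSpace (A : H →ₗ.[ℝ] H) : Type u := WithLp 2 (SpaceH2 A × WithLp 2 (H × H))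

/-- The element `(u, v, θ)` of the phase space. -/
def PhaseSpace.mk {A : H →ₗ.[ℝ] H} (u : SpaceH2 A) (v θ : H) : PhaseSpace A :=
  WithLp.toLp 2 (u, WithLp.toLp 2 (v, θ))

/-- The first component of a state. -/
def PhaseSpace.disp {A : H →ₗ.[ℝ] H} (z : PhaseSpace A) : SpaceH2 A := z.fst

/-- The second component of a state. -/
def PhaseSpace.vel {A : H →ₗ.[ℝ] H} (z : PhaseSpace A) : H := z.snd.fst

/-- The third component of a state. -/
def PhaseSpace.temp {A : H →ₗ.[ℝ] H} (z : PhaseSpace A) : H := z.snd.snd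

/-- `U = (u, ∂ₜu, θ)`, restricted to `[0, ∞)`, is a weak solution, continuous with values in the
phase space and with initial state `z`, of
`∂ₜₜu + A u - A ^ (1/2) θ + (β + ‖u‖₁ ^ 2) A ^ (1/2) u = f`,
`∂ₜθ + A ^ (1/2) θ + A ^ (1/2) ∂ₜu = g`,
with time-independent `f, g ∈ H`. Here `‖u‖₁ = ‖A ^ (1/4) u‖`, and both equations are
tested with all `φ ∈ H²`. -/
structure IsWeakSolution (A : H →ₗ.[ℝ] H) (β : ℝ) (f g : H) (z : PhaseSpace A)
    (U : ℝ → PhaseSpace A) : Prop where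
  continuousOn : ContinuousOn U (Ici 0)
  initial : U 0 = z
  velocity : ∀ t : ℝ, 0 ≤ t →
    HasDerivWithinAt (fun s => (U s).disp.val) (U t).vel (Ici 0) t
  momentum : ∀ φ : SpaceH2 A, ∀ t : ℝ, 0 ≤ t →
    HasDerivWithinAt (fun s => inner ℝ (U s).vel φ.val)
      (inner ℝ f φ.val
        - inner ℝ (sqrtMap A (U t).disp) (sqrtMap A φ)
        + inner ℝ (U t).temp (sqrtMap A φ)
        - (β + ‖opPow A (1 / 4) (U t).disp.val‖ ^ 2) * inner ℝ (sqrtMap A (U t).disp) φ.val)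
      (Ici 0) t
  heat : ∀ φ : SpaceH2 A, ∀ t : ℝ, 0 ≤ t →
    HasDerivWithinAt (fun s => inner ℝ (U s).temp φ.val)
      (inner ℝ g φ.val
        - inner ℝ (U t).temp (sqrtMap A φ)
        - inner ℝ (U t).vel (sqrtMap A φ))
      (Ici 0) t

open Classical in
/-- The solution operator `S(t)`, that maps `z` to the state at time `t` of the weak solution that
starts at `z` (and to `0` if there were none). -/
noncomputable def solutionOp (A : H →ₗ.[ℝ] H) (β : ℝ) (f g : H) (t : ℝ) (z : PhaseSpace A) :
    PhaseSpace A :=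
  if h : ∃ U : ℝ → PhaseSpace A, IsWeakSolution A β f g z U then h.choose t else 0

/-- The state `z_g = (0, 0, A ^ (-1/2) g)`. -/
noncomputable def zState (A : H →ₗ.[ℝ] H) (g : H) : PhaseSpace A :=
  PhaseSpace.mk 0 0 (opPow A (-(1 / 2)) g)

end Operator

section Attractor

variable {X : Type u} [SeminormedAddCommGroup X]

/-- The Hausdorff semidistance `δ(B, C) = sup_{b ∈ B} inf_{c ∈ C} ‖b - c‖`. -/
noncomputable def semidist (B C : Set X) : ℝ≥0∞ := ⨆ b ∈ B, Metric.infEDist b C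

/-- `K` is a global attractor of the operators `S(t)`, `t ≥ 0`: it is compact, fully invariant, and
attracts every bounded set. -/
structure IsGlobalAttractor (S : ℝ → X → X) (K : Set X) : Prop where
  compact : IsCompact K
  invariant : ∀ t : ℝ, 0 ≤ t → S t '' K = K
  attracting : ∀ B : Set X, Bornology.IsBounded B →
    Tendsto (fun t : ℝ => semidist (S t '' B) K) atTop (𝓝 0)

/-- `‖B‖ = sup_{z ∈ B} ‖z‖`, for a bounded set `B` (and `‖∅‖ = 0`). -/
noncomputable def setNorm (B : Set X) : ℝ := ⨆ z : B, ‖(z : X)‖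

end Attractor

/-- Explicit elementary formulas in `n` real variables: they are built from the variables and from
rational constants by sums, products, negatives, inverses, maxima, square roots, `exp` and
`log`. -/
inductive Formula (n : ℕ) : Type
  | var (i : Fin n) : Formula n
  | const (q : ℚ) : Formula n
  | add (a b : Formula n) : Formula n
  | mul (a b : Formula n) : Formula n
  | neg (a : Formula n) : Formula n
  | inv (a : Formula n) : Formula n
  | max (a b : Formula n) : Formula n
  | sqrt (a : Formula n) : Formula n
  | exp (a : Formula n) : Formula n
  | log (a : Formula n) : Formula n

/-- The value of a formula at given values of the variables. -/
noncomputable def Formula.eval {n : ℕ} (x : Fin n → ℝ) : Formula n → ℝ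
  | .var i => x i
  | .const q => (q : ℝ)
  | .add a b => a.eval x + b.eval x
  | .mul a b => a.eval x * b.eval x
  | .neg a => -a.eval x
  | .inv a => (a.eval x)⁻¹
  | .max a b => Max.max (a.eval x) (b.eval x)
  | .sqrt a => Real.sqrt (a.eval x)
  | .exp a => Real.exp (a.eval x)
  | .log a => Real.log (a.eval x)

end ThermoBeam

-- Put L = A^(1/2), M = L⁻¹, l = √λ₁, x = L u, v = ∂ₜu and w = θ - M g. Since f + g = 0, the sources
-- cancel and the problem becomes x' = L v, v' = -L x + L w - (β + p) x, w' = -L w - L v with p = ⟪M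
-- x, x⟫ = ‖u‖₁². The phase norm becomes that of H × H × H, and z_g becomes the rest point 0. All
-- claims follow from well-posedness and exponential decay to 0 at a rate independent of the data.
--
-- Decay. The energy E = (‖x‖² + ‖v‖² + ‖w‖²)/2 + βp/2 + p²/4 satisfies E' = -D with D = ⟪L w, w⟫.
-- As 0 ≤ p ≤ ‖x‖²/l, the condition β > -l makes E coercive. The dissipation sees only w; the
-- multiplier P = ⟪M x, v⟫ + 2⟪M w, v⟫ recovers x and v, up to a multiple of ‖w‖² ≤ D/l and the
-- quartic term -2p⟪M w, x⟫. A small weight ε on P handles the former, but cannot handle the latter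
-- uniformly in the data. The quartic term is, however, at most p²/2 plus a multiple of E·D, and
-- because E' = -D an integrating factor exp(cE) absorbs E·D. So (E + εP) exp(cE) decays at a rate
-- depending on β and l only, and the size of the data enters the prefactor alone (`multiplier_le`,
-- `lyapunov_core`, `sq_norm_le_of_solution`).
--
-- Well-posedness. The nonlinearity is a scalar multiple of x, so spans of finitely many
-- eigenvectors are invariant; there the system is an ODE, global by the energy bound
-- (`exists_galerkin_solution`). For the difference of two solutions the unbounded couplings cancel
-- mode by mode and the force is locally Lipschitz (`IsModeSolution.triSq_sub_le`). This gives
-- uniqueness, and it makes the finite-mode solutions Cauchy locally uniformly in time, so that the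
-- decay estimate passes to the limit (`exists_strongSolution`).
--
-- The eigenbasis comes from the compact symmetric inverse of A
-- (`IsBeamOperator.exists_eigenbasis`). It makes the spectral powers diagonal, which translates
-- weak solutions into the coordinates (x, v, w) and back. Finally, a rest point attracting bounded
-- sets uniformly is the only global attractor (`isGlobalAttractor_iff_eq_singleton`).

namespace ThermoBeam

-- Forward ODEs, integrals and Gronwall inequalities on [0, ∞)

section Calculus

theorem intervalIntegrable_of_continuousOn_Ici {E : Type*} [NormedAddCommGroup E]
    {r : ℝ → E} (hr : ContinuousOn r (Ici 0)) {t : ℝ}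
    (ht : 0 ≤ t) : IntervalIntegrable r MeasureTheory.volume 0 t :=
  (hr.mono (by rw [uIcc_of_le ht]; exact Icc_subset_Ici_self)).intervalIntegrable

variable {E : Type*} [NormedAddCommGroup E] [NormedSpace ℝ E]

/-- A bounded Lipschitz vector field on a Banach space has global forward solutions. -/
theorem exists_forward_solution [CompleteSpace E] {F : E → E} {K C : NNReal}
    (hF : LipschitzWith K F) (hC : ∀ y, ‖F y‖ ≤ C) (y₀ : E) :
    ∃ y : ℝ → E, y 0 = y₀ ∧ ∀ t, 0 ≤ t → HasDerivWithinAt y (F (y t)) (Ici 0) t := by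
  have hloc : ∀ T : ℝ, ∃ α : ℝ → E, 0 ≤ T → α 0 = y₀ ∧
      ∀ t ∈ Icc 0 T, HasDerivWithinAt α (F (α t)) (Icc 0 T) t := by
    intro T
    by_cases hT : 0 ≤ T
    -- The field is bounded by `C` everywhere, so the ball of radius `C * T` confines the solution
    -- up to any prescribed time `T`.
    · have hP : IsPicardLindelof (fun _ => F) (⟨0, le_rfl, hT⟩ : Icc (0 : ℝ) T) y₀
          (C * T.toNNReal) 0 C K :=
        { lipschitzOnWith := fun t _ => hF.lipschitzOnWith
          continuousOn := fun _ _ => continuousOn_const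
          norm_le := fun t _ x _ => hC x
          mul_max_le := by simp [hT] }
      obtain ⟨α, h0, hα⟩ := hP.exists_eq_forall_mem_Icc_hasDerivWithinAt₀
      exact ⟨α, fun _ => ⟨h0, hα⟩⟩
    · exact ⟨0, fun h => absurd h hT⟩
  choose α hα using hloc
  have hright : ∀ T, 0 ≤ T → ∀ T', T' ≤ T → ∀ t ∈ Ico 0 T',
      HasDerivWithinAt (α T) (F (α T t)) (Ici t) t := by
    intro T hT T' hT' t ht
    refine ((hα T hT).2 t ⟨ht.1, ht.2.le.trans hT'⟩).mono_of_mem_nhdsWithin ?_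
    exact mem_of_superset (Icc_mem_nhdsGE (ht.2.trans_le hT')) (Icc_subset_Icc_left ht.1)
  have hcont : ∀ T, 0 ≤ T → ∀ T', T' ≤ T → ContinuousOn (α T) (Icc 0 T') := fun T hT T' hT' t ht =>
    (((hα T hT).2 t ⟨ht.1, ht.2.trans hT'⟩).continuousWithinAt).mono (Icc_subset_Icc_right hT')
  have hagree : ∀ T T', 0 ≤ T' → T' ≤ T → EqOn (α T) (α T') (Icc 0 T') := by
    intro T T' hT' h
    have hT := hT'.trans h
    exact ODE_solution_unique (v := fun _ => F) (fun _ => hF) (hcont T hT T' h)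
      (hright T hT T' h) (hcont T' hT' T' le_rfl) (hright T' hT' T' le_rfl)
      ((hα T hT).1.trans (hα T' hT').1.symm)
  have heq : ∀ T t, 0 ≤ t → t ≤ T → α (t + 1) t = α T t := by
    intro T t ht htT
    rw [hagree (t + 1) t ht (by linarith) ⟨ht, le_rfl⟩, hagree T t ht htT ⟨ht, le_rfl⟩]
  -- At time `t` the solution on `[0, t + 1]` is used: the extra unit of time keeps `t` away from
  -- the right end, so its derivative within `Icc` is one within `Ici 0`.
  refine ⟨fun t => α (t + 1) t, ?_, fun t ht => ?_⟩
  · simpa using (hα 1 zero_le_one).1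
  · have h1 := (hα (t + 1) (by linarith)).2 t ⟨ht, by linarith⟩
    have hmem : Icc 0 (t + 1) ∈ 𝓝[Ici 0] t := by
      rw [show Icc 0 (t + 1) = Ici 0 ∩ Iic (t + 1) from (Ici_inter_Iic).symm]
      exact inter_mem_nhdsWithin _ (Iic_mem_nhds (by linarith))
    refine (h1.congr_of_eventuallyEq_of_mem ?_ ⟨ht, by linarith⟩).mono_of_mem_nhdsWithin hmem
    filter_upwards [self_mem_nhdsWithin] with s hs
    exact heq (t + 1) s hs.1 hs.2

/-- Freezing `r` at `r 0` for negative times extends it continuously to the line, where the usual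
fundamental theorem of calculus applies. -/
theorem continuous_comp_max_zero {E : Type*} [TopologicalSpace E] {r : ℝ → E}
    (hr : ContinuousOn r (Ici 0)) :
    Continuous fun t => r (max 0 t) :=
  hr.comp_continuous (by fun_prop) fun t => mem_Ici.2 (le_max_left 0 t)

variable [CompleteSpace E]

/-- Forward differentiability of an integral whose integrand is continuous on `[0, ∞)`. -/
theorem hasDerivWithinAt_integral {r : ℝ → E} (hr : ContinuousOn r (Ici 0)) {t : ℝ} (ht : 0 ≤ t) :
    HasDerivWithinAt (fun t => ∫ s in (0 : ℝ)..t, r s) (r t) (Ici 0) t := by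
  have hc := continuous_comp_max_zero hr
  have h := (hc.integral_hasStrictDerivAt 0 t).hasDerivAt.hasDerivWithinAt (s := Ici 0)
  rw [max_eq_right ht] at h
  refine h.congr_of_mem (fun s hs => ?_) ht
  refine intervalIntegral.integral_congr fun a ha => ?_
  rw [uIcc_of_le hs] at ha
  simp [max_eq_right ha.1]

/-- The fundamental theorem of calculus on `[0, ∞)`. -/
theorem eq_add_integral {y r : ℝ → E} (hr : ContinuousOn r (Ici 0))
    (hy : ∀ t, 0 ≤ t → HasDerivWithinAt y (r t) (Ici 0) t) {t : ℝ} (ht : 0 ≤ t) :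
    y t = y 0 + ∫ s in (0 : ℝ)..t, r s := by
  have h := intervalIntegral.integral_eq_sub_of_hasDeriv_right (f := y) (f' := r) (a := 0) (b := t)
    (fun s hs => ?_) (fun s hs => ?_) (intervalIntegrable_of_continuousOn_Ici hr ht)
  · rw [h]; abel
  · rw [uIcc_of_le ht] at hs ⊢
    exact ((hy s hs.1).continuousWithinAt).mono Icc_subset_Ici_self
  · rw [min_eq_left ht] at hs
    exact (hy s hs.1.le).mono fun a ha => hs.1.le.trans (le_of_lt ha)

/-- Locally uniform limits of forward derivatives. -/
theorem hasDerivWithinAt_of_tendstoUniformlyOn {α : Type*} {l : Filter α} [l.NeBot]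
    {y r : α → ℝ → E} {y' r' : ℝ → E} (hr : ∀ a, ContinuousOn (r a) (Ici 0))
    (hr' : ContinuousOn r' (Ici 0))
    (hy : ∀ a t, 0 ≤ t → HasDerivWithinAt (y a) (r a t) (Ici 0) t)
    (hlim : ∀ t, 0 ≤ t → Tendsto (fun a => y a t) l (𝓝 (y' t)))
    (hunif : ∀ T, 0 ≤ T → TendstoUniformlyOn r r' l (Icc 0 T)) {t : ℝ} (ht : 0 ≤ t) :
    HasDerivWithinAt y' (r' t) (Ici 0) t := by
  -- The integral identity survives a locally uniform limit; differentiability is then read off from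
  -- it.
  have key : ∀ t, 0 ≤ t → y' t = y' 0 + ∫ s in (0 : ℝ)..t, r' s := by
    intro t ht
    refine tendsto_nhds_unique (hlim t ht) ?_
    have h1 : Tendsto (fun a => ∫ s in (0 : ℝ)..t, r a s) l (𝓝 (∫ s in (0 : ℝ)..t, r' s)) := by
      rw [Metric.tendsto_nhds]
      intro ε hε
      filter_upwards [Metric.tendstoUniformlyOn_iff.1 (hunif t ht) (ε / (t + 1)) (by positivity)]
        with a ha
      rw [dist_eq_norm, ← intervalIntegral.integral_sub
        (intervalIntegrable_of_continuousOn_Ici (hr a) ht)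
        (intervalIntegrable_of_continuousOn_Ici hr' ht)]
      have := intervalIntegral.norm_integral_le_of_norm_le_const (a := 0) (b := t)
        (f := fun s => r a s - r' s) (C := ε / (t + 1)) (fun s hs => by
          rw [uIoc_of_le ht] at hs
          have := ha s ⟨hs.1.le, hs.2⟩
          rw [dist_comm, dist_eq_norm] at this
          exact this.le)
      refine this.trans_lt ?_
      rw [sub_zero, abs_of_nonneg ht, div_mul_eq_mul_div, div_lt_iff₀ (by positivity)]
      nlinarith
    exact ((hlim 0 le_rfl).add h1).congr fun a => (eq_add_integral (hr a) (hy a) ht).symm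
  have h := (hasDerivWithinAt_integral hr' ht).const_add (y' 0)
  exact h.congr_of_mem (fun s hs => key s hs) ht

theorem monotoneOn_Ici_of_deriv {f f' : ℝ → ℝ}
    (hf : ∀ t, 0 ≤ t → HasDerivWithinAt f (f' t) (Ici 0) t) (hf' : ∀ t, 0 ≤ t → 0 ≤ f' t) :
    MonotoneOn f (Ici 0) := by
  refine monotoneOn_of_hasDerivWithinAt_nonneg (f' := f') (convex_Ici 0)
    (fun t ht => (hf t ht).continuousWithinAt) (fun t ht => ?_) (fun t ht => ?_)
  · exact (hf t (interior_subset ht)).mono interior_subset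
  · exact hf' t (interior_subset ht)

/-- Gronwall's inequality in exponential form. -/
theorem le_mul_exp_of_deriv_le {f f' : ℝ → ℝ} {c : ℝ}
    (hf : ∀ t, 0 ≤ t → HasDerivWithinAt f (f' t) (Ici 0) t) (hf' : ∀ t, 0 ≤ t → f' t ≤ c * f t)
    {t : ℝ} (ht : 0 ≤ t) : f t ≤ f 0 * Real.exp (c * t) := by
  have hd : ∀ t, 0 ≤ t → HasDerivWithinAt (fun t => -(f t * Real.exp (-(c * t))))
      (-(f' t * Real.exp (-(c * t)) + f t * (Real.exp (-(c * t)) * -(c * 1)))) (Ici 0) t :=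
    fun t ht => ((hf t ht).mul
      (((hasDerivAt_id t).const_mul c).neg.exp.hasDerivWithinAt)).neg
  have hm := monotoneOn_Ici_of_deriv hd (fun t ht => by
    have := mul_le_mul_of_nonneg_right (hf' t ht) (Real.exp_pos (-(c * t))).le
    linarith)
  have h := hm (mem_Ici.2 le_rfl) (mem_Ici.2 ht) ht
  simp only [mul_zero, neg_zero, Real.exp_zero, mul_one, neg_le_neg_iff] at h
  have h2 := mul_le_mul_of_nonneg_right h (Real.exp_pos (c * t)).le
  rwa [mul_assoc, ← Real.exp_add, neg_add_cancel, Real.exp_zero, mul_one] at h2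

/-- Gronwall's inequality in integral form. -/
theorem le_mul_exp_of_le_integral {φ : ℝ → ℝ} {c : ℝ} (hc : 0 ≤ c)
    (hφ : ContinuousOn φ (Ici 0)) {T : ℝ}
    (h : ∀ t ∈ Icc 0 T, φ t ≤ φ 0 + c * ∫ s in (0 : ℝ)..t, φ s) {t : ℝ} (ht : t ∈ Icc 0 T) :
    φ t ≤ φ 0 * Real.exp (c * t) := by
  have hb : ∀ s ∈ Icc 0 T, HasDerivWithinAt (fun t => φ 0 + c * ∫ s in (0 : ℝ)..t, φ s)
      (c * φ s) (Ici 0) s := fun s hs =>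
    ((hasDerivWithinAt_integral hφ hs.1).const_mul c).const_add _
  have := le_gronwallBound_of_liminf_deriv_right_le (a := 0) (b := T)
    (f := fun t => φ 0 + c * ∫ s in (0 : ℝ)..t, φ s) (f' := fun s => c * φ s) (δ := φ 0)
    (K := c) (ε := 0)
    (fun s hs => (hb s hs).continuousWithinAt.mono Icc_subset_Ici_self)
    (fun s hs r hr => ((hb s ⟨hs.1, hs.2.le⟩).mono
      (Ici_subset_Ici.2 hs.1)).liminf_right_slope_le hr)
    (by simp) (fun s hs => by
      have := mul_le_mul_of_nonneg_left (h s ⟨hs.1, hs.2.le⟩) hc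
      simpa using this) t ht
  rw [gronwallBound_ε0, sub_zero] at this
  exact (h t ht).trans this

end Calculus

-- Explicit constants and the algebra of the Lyapunov estimate

section Constants

/-- The coercivity constant `min 1 (1 + β / l)`. -/
noncomputable def coercivity (β l : ℝ) : ℝ := 1 - max 0 (-β) / l

/-- The growth constant `1 + |β| / l` of the energy. -/
noncomputable def growth (β l : ℝ) : ℝ := 1 + max β (-β) / l

/-- The constant in front of `‖w‖ ^ 2` in the derivative of the multiplier functional. -/
noncomputable def multConst (β l : ℝ) : ℝ :=
  4 + 1 / coercivity β l + 4 * β ^ 2 / (coercivity β l * l ^ 2)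

/-- The weight of the multiplier functional in the Lyapunov functional. -/
noncomputable def lyapWeight (β l : ℝ) : ℝ := l / (2 * (multConst β l + 3 / coercivity β l))

/-- The coefficient of the energy in the integrating factor. -/
noncomputable def factorRate (β l : ℝ) : ℝ :=
  2 * (lyapWeight β l * (4 / (coercivity β l * l ^ 3)))

/-- The decay rate of the squared norm. -/
noncomputable def sqRate (β l : ℝ) : ℝ :=
  2 * (lyapWeight β l * coercivity β l / growth β l) / 3

/-- A bound of the energy by the squared norm `ρ`. -/
noncomputable def energyBound (β l ρ : ℝ) : ℝ := growth β l * ρ / 2 + ρ ^ 2 / (4 * l ^ 2)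

/-- The prefactor in the decay estimate of the squared norm. -/
noncomputable def sqBound (β l ρ : ℝ) : ℝ :=
  6 / coercivity β l * (energyBound β l ρ * Real.exp (factorRate β l * energyBound β l ρ))

variable {β l : ℝ}

theorem coercivity_pos (hl : 0 < l) (hβ : -l < β) : 0 < coercivity β l := by
  have : max 0 (-β) / l < 1 := by rw [div_lt_one hl]; exact max_lt hl (by linarith)
  simp only [coercivity]; linarith

theorem coercivity_le_one (hl : 0 < l) : coercivity β l ≤ 1 := by
  have : 0 ≤ max 0 (-β) / l := div_nonneg (le_max_left _ _) hl.le
  simp only [coercivity]; linarith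

/-- Only the negative part of β can hurt, and `p ≤ N / l` limits the damage. In the applications `N`
is ‖x‖² and `p` is ⟪M x, x⟫. -/
theorem coercivity_mul_le {N p : ℝ} (hp : 0 ≤ p) (hpN : p ≤ N / l) :
    coercivity β l * N ≤ N + β * p := by
  have h1 : -β * p ≤ max 0 (-β) * (N / l) :=
    (mul_le_mul_of_nonneg_right (le_max_right 0 (-β)) hp).trans
      (mul_le_mul_of_nonneg_left hpN (le_max_left _ _))
  have h2 : max 0 (-β) / l * N = max 0 (-β) * (N / l) := by ring
  simp only [coercivity]; linarith

theorem one_le_growth (hl : 0 < l) : 1 ≤ growth β l := by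
  have : 0 ≤ |β| / l := by positivity
  simp only [growth, ← abs_eq_max_neg]; linarith

theorem mul_le_growth {N p : ℝ} (hp : 0 ≤ p) (hpN : p ≤ N / l) :
    N + β * p ≤ growth β l * N := by
  have h1 : β * p ≤ |β| * (N / l) :=
    (mul_le_mul_of_nonneg_right (le_abs_self β) hp).trans
      (mul_le_mul_of_nonneg_left hpN (abs_nonneg _))
  have h2 : |β| / l * N = |β| * (N / l) := by ring
  simp only [growth, ← abs_eq_max_neg]; linarith

theorem four_le_multConst (hl : 0 < l) (hβ : -l < β) : 4 ≤ multConst β l := by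
  have := coercivity_pos hl hβ
  have h1 : 0 ≤ 1 / coercivity β l := by positivity
  have h2 : 0 ≤ 4 * β ^ 2 / (coercivity β l * l ^ 2) := by positivity
  simp only [multConst]; linarith

theorem lyapWeight_pos (hl : 0 < l) (hβ : -l < β) : 0 < lyapWeight β l := by
  have := coercivity_pos hl hβ
  have := four_le_multConst hl hβ
  have : 0 < multConst β l := by linarith
  unfold lyapWeight; positivity

/-- First demand on the weight: the ‖w‖² term of the multiplier costs at most half of the
dissipation, as D ≥ l‖w‖². -/
theorem lyapWeight_mul_multConst_le (hl : 0 < l) (hβ : -l < β) :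
    lyapWeight β l * multConst β l ≤ l / 2 := by
  have hg := coercivity_pos hl hβ
  have := four_le_multConst hl hβ
  have hC : 0 < multConst β l := by linarith
  have h3 : 0 < 3 / coercivity β l := by positivity
  rw [lyapWeight, div_mul_eq_mul_div, div_le_iff₀ (by positivity)]
  nlinarith

/-- Second demand on the weight: the weighted multiplier is at most half of the energy. -/
theorem lyapWeight_mul_le (hl : 0 < l) (hβ : -l < β) :
    lyapWeight β l * (3 / (coercivity β l * l)) ≤ 1 / 2 := by
  have hg := coercivity_pos hl hβ
  have := four_le_multConst hl hβ
  have hC : 0 < multConst β l := by linarith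
  have h3 : 0 < 3 / coercivity β l := by positivity
  have : 3 / (coercivity β l * l) = 3 / coercivity β l / l := by rw [div_div]
  rw [this, lyapWeight, div_mul_div_comm, div_le_iff₀ (by positivity)]
  nlinarith

theorem factorRate_pos (hl : 0 < l) (hβ : -l < β) : 0 < factorRate β l := by
  have hg := coercivity_pos hl hβ
  have := lyapWeight_pos hl hβ
  unfold factorRate; positivity

theorem sqRate_pos (hl : 0 < l) (hβ : -l < β) : 0 < sqRate β l := by
  have hg := coercivity_pos hl hβ
  have := lyapWeight_pos hl hβ
  have : 0 < growth β l := one_pos.trans_le (one_le_growth hl)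
  unfold sqRate; positivity

theorem energyBound_strictMonoOn (hl : 0 < l) :
    StrictMonoOn (energyBound β l) (Ici 0) := by
  intro a ha b hb hab
  rw [mem_Ici] at ha
  have hg : 0 < growth β l := one_pos.trans_le (one_le_growth hl)
  unfold energyBound
  gcongr

theorem energyBound_nonneg (hl : 0 < l) {ρ : ℝ} (hρ : 0 ≤ ρ) : 0 ≤ energyBound β l ρ := by
  have hg : 0 < growth β l := one_pos.trans_le (one_le_growth hl)
  unfold energyBound; positivity

theorem sqBound_strictMonoOn (hl : 0 < l) (hβ : -l < β) :
    StrictMonoOn (sqBound β l) (Ici 0) := by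
  intro a ha b hb hab
  have h := energyBound_strictMonoOn (β := β) hl ha hb hab
  have h0 := energyBound_nonneg (β := β) hl (mem_Ici.1 ha)
  have hg := coercivity_pos hl hβ
  have hf := factorRate_pos hl hβ
  have hE : Real.exp (factorRate β l * energyBound β l a) ≤
      Real.exp (factorRate β l * energyBound β l b) :=
    Real.exp_le_exp.2 (mul_le_mul_of_nonneg_left h.le hf.le)
  unfold sqBound
  refine mul_lt_mul_of_pos_left ?_ (by positivity)
  exact mul_lt_mul h hE (Real.exp_pos _) (h0.trans h.le)

theorem sqBound_nonneg (hl : 0 < l) (hβ : -l < β) {ρ : ℝ} (hρ : 0 ≤ ρ) : 0 ≤ sqBound β l ρ := by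
  have h0 := energyBound_nonneg (β := β) hl hρ
  have hg := coercivity_pos hl hβ
  unfold sqBound; positivity

/-- The derivative of the multiplier functional, up to the multiples of the dissipation. -/
theorem multiplier_le (hl : 0 < l) (hβ : -l < β) {X Y W p D q s r : ℝ}
    (hp : 0 ≤ p) (hpX : p ≤ X ^ 2 / l) (hD : l * W ^ 2 ≤ D)
    (hq : |q| ≤ X * W) (hs : |s| ≤ W * Y) (hr : |r| ≤ W * X / l) {En : ℝ}
    (hEn : En = (X ^ 2 + Y ^ 2 + W ^ 2) / 2 + β * p / 2 + p ^ 2 / 4) :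
    -Y ^ 2 - X ^ 2 - (β + p) * p - q - 2 * s + 2 * W ^ 2 - 2 * ((β + p) * r) ≤
      -(coercivity β l * X ^ 2 + Y ^ 2 + p ^ 2) / 2 + multConst β l * W ^ 2 +
        4 / (coercivity β l * l ^ 3) * (En * D) := by
  have hg := coercivity_pos hl hβ
  have hco := coercivity_mul_le (β := β) hp hpX
  have hCdef : multConst β l =
    4 + 1 / coercivity β l + 4 * β ^ 2 / (coercivity β l * l ^ 2) := rfl
  generalize coercivity β l = g at *
  generalize multConst β l = C at *
  -- Young's inequality gives `g / 4 * X ^ 2` to each of the two cross terms `q` and `β * r`, so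
  -- half of the `g * X ^ 2` from `hco` survives; the matching coefficients of `W ^ 2` add up to
  -- `multConst`.
  have b1 : -q ≤ g / 4 * X ^ 2 + 1 / g * W ^ 2 := by
    have h1 : X * W ≤ g / 4 * X ^ 2 + 1 / g * W ^ 2 := by
      have : g / 4 * X ^ 2 + 1 / g * W ^ 2 - X * W = (g * X / 2 - W) ^ 2 / g := by
        field_simp; ring
      have h2 : 0 ≤ (g * X / 2 - W) ^ 2 / g := by positivity
      linarith
    linarith [neg_abs_le q]
  have b2 : -(2 * s) ≤ Y ^ 2 / 2 + 2 * W ^ 2 := by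
    linarith only [hs, neg_abs_le s, sq_nonneg (Y - 2 * W)]
  have b3 : -(2 * (β * r)) ≤ g / 4 * X ^ 2 + 4 * β ^ 2 / (g * l ^ 2) * W ^ 2 := by
    have h0 : -(2 * (β * r)) ≤ 2 * (|β| * (W * X / l)) := by
      have h1 : |β * r| ≤ |β| * (W * X / l) := by
        rw [abs_mul]; exact mul_le_mul_of_nonneg_left hr (abs_nonneg _)
      linarith [neg_abs_le (β * r)]
    have h1 : g / 4 * X ^ 2 + 4 * |β| ^ 2 / (g * l ^ 2) * W ^ 2 - 2 * (|β| * (W * X / l)) =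
        (g * X / 2 - 2 * |β| * W / l) ^ 2 / g := by
      field_simp; ring
    have h2 : 0 ≤ (g * X / 2 - 2 * |β| * W / l) ^ 2 / g := by positivity
    rw [sq_abs] at h1
    linarith
  have hEg : g * X ^ 2 / 2 ≤ En := by rw [hEn]; linarith only [hco, sq_nonneg Y, sq_nonneg W, sq_nonneg p]
  -- The quartic term: Young leaves a multiple of `X ^ 2 * W ^ 2`, which is bounded by energy times
  -- dissipation.
  have b4 : -(2 * (p * r)) ≤ p ^ 2 / 2 + 4 / (g * l ^ 3) * (En * D) := by
    have h0 : -(2 * (p * r)) ≤ 2 * (p * (W * X / l)) := by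
      have h1 : |p * r| ≤ p * (W * X / l) := by
        rw [abs_mul, abs_of_nonneg hp]; exact mul_le_mul_of_nonneg_left hr hp
      linarith [neg_abs_le (p * r)]
    have h1 : 2 * (p * (W * X / l)) ≤ p ^ 2 / 2 + 2 * (W * X / l) ^ 2 := by
      linarith only [sq_nonneg (p - 2 * (W * X / l))]
    have h2 : 2 * (W * X / l) ^ 2 = 4 / (g * l ^ 3) * ((g * X ^ 2 / 2) * (l * W ^ 2)) := by
      field_simp; ring
    have h3 : (g * X ^ 2 / 2) * (l * W ^ 2) ≤ En * D :=
      mul_le_mul hEg hD (by positivity) ((by positivity : 0 ≤ g * X ^ 2 / 2).trans hEg)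
    have h4 := mul_le_mul_of_nonneg_left h3 (by positivity : 0 ≤ 4 / (g * l ^ 3))
    linarith
  rw [hCdef]
  generalize 4 * β ^ 2 / (g * l ^ 2) = c₃ at b3 ⊢
  generalize 4 / (g * l ^ 3) * (En * D) = c₄ at b4 ⊢
  generalize 1 / g = c₁ at b1 ⊢
  linarith only [b1, b2, b3, b4, hco]

/-- The algebraic core of the Lyapunov estimate. -/
theorem lyapunov_core (hl : 0 < l) (hβ : -l < β) {X Y W p D q s r : ℝ}
    (hp : 0 ≤ p) (hpX : p ≤ X ^ 2 / l) (hD : l * W ^ 2 ≤ D)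
    (hq : |q| ≤ X * W) (hs : |s| ≤ W * Y) (hr : |r| ≤ W * X / l) {En : ℝ}
    (hEn : En = (X ^ 2 + Y ^ 2 + W ^ 2) / 2 + β * p / 2 + p ^ 2 / 4) :
    -D + lyapWeight β l * (-Y ^ 2 - X ^ 2 - (β + p) * p - q - 2 * s + 2 * W ^ 2
        - 2 * ((β + p) * r)) ≤
      -(lyapWeight β l * coercivity β l / growth β l) * En +
        lyapWeight β l * (4 / (coercivity β l * l ^ 3)) * (En * D) := by
  have hg := coercivity_pos hl hβ
  have hg1 := coercivity_le_one (β := β) hl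
  have hB := one_le_growth (β := β) hl
  have hε := lyapWeight_pos hl hβ
  have hC4 := four_le_multConst hl hβ
  have hεC := lyapWeight_mul_multConst_le hl hβ
  have hco := coercivity_mul_le (β := β) hp hpX
  have hgr := mul_le_growth (β := β) hp hpX
  have hbr := multiplier_le hl hβ hp hpX hD hq hs hr hEn
  set g := coercivity β l
  set B := growth β l
  set ε := lyapWeight β l
  set C := multConst β l
  clear_value g B ε C
  have hD0 : 0 ≤ D := (by positivity : 0 ≤ l * W ^ 2).trans hD
  have hmul := mul_le_mul_of_nonneg_left hbr hε.le
  -- Half of the dissipation pays for the `W ^ 2` term of the multiplier; the other half, in `hW3`,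
  -- supplies the `W ^ 2` part of the energy, which the multiplier does not produce.
  have hW2 : ε * (C * W ^ 2) ≤ D / 2 := by
    have := mul_le_mul_of_nonneg_right hεC (sq_nonneg W)
    linarith only [this, hD]
  have hW3 : ε * (g * W ^ 2) / 2 ≤ D / 2 := by
    have : ε * (g * W ^ 2) ≤ ε * (C * W ^ 2) :=
      mul_le_mul_of_nonneg_left (mul_le_mul_of_nonneg_right (by linarith) (sq_nonneg W)) hε.le
    linarith only [this, hW2, hD0]
  have hEB : g / B * En ≤ (g * (X ^ 2 + Y ^ 2 + W ^ 2) + p ^ 2) / 2 := by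
    have hB0 : 0 < B := by linarith
    have h1 : En ≤ B * (X ^ 2 + Y ^ 2 + W ^ 2) / 2 + p ^ 2 / 4 := by
      
      have hY := mul_le_mul_of_nonneg_right hB (sq_nonneg Y)
      have hW := mul_le_mul_of_nonneg_right hB (sq_nonneg W)
      rw [hEn]; linarith only [hY, hW, hgr]
    have h2 := mul_le_mul_of_nonneg_left h1 (by positivity : 0 ≤ g / B)
    have h3 : g / B * (B * (X ^ 2 + Y ^ 2 + W ^ 2) / 2 + p ^ 2 / 4) =
      g * (X ^ 2 + Y ^ 2 + W ^ 2) / 2 + g / B * (p ^ 2 / 4) := by field_simp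
    have h4 : g / B ≤ 1 := by rw [div_le_one hB0]; linarith
    have h5 := mul_le_mul_of_nonneg_right h4 (by positivity : 0 ≤ p ^ 2 / 4)
    linarith only [h2, h3, h5, sq_nonneg p]
  have hEB' := mul_le_mul_of_nonneg_left hEB hε.le
  have e1 : ε * g / B * En = ε * (g / B * En) := by ring
  have e2 : ε * (4 / (g * l ^ 3)) * (En * D) = ε * (4 / (g * l ^ 3) * (En * D)) := by ring
  rw [neg_mul, e1, e2]
  have hYg : ε * (g * Y ^ 2) ≤ ε * Y ^ 2 :=
    mul_le_mul_of_nonneg_left (mul_le_of_le_one_left (sq_nonneg Y) hg1) hε.le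
  linarith only [hmul, hW2, hW3, hEB', hYg]

end Constants

-- Energy, multiplier and decay for bounded operators

section FiniteDimensional

variable {V : Type*} [NormedAddCommGroup V] [InnerProductSpace ℝ V]

/-- `L` is a bounded symmetric operator, bounded below by `l`, with inverse `M`. -/
structure IsPositivePair (l : ℝ) (L M : V →L[ℝ] V) : Prop where
  left_inv : ∀ x, M (L x) = x
  right_inv : ∀ x, L (M x) = x
  symm : ∀ x y, inner ℝ (L x) y = inner ℝ x (L y)
  coercive : ∀ x, l * ‖x‖ ^ 2 ≤ inner ℝ (L x) x

namespace IsPositivePair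

variable {l : ℝ} {L M : V →L[ℝ] V}

theorem symm_inv (h : IsPositivePair l L M) (x y : V) :
    inner ℝ (M x) y = inner ℝ x (M y) := by
  rw [← h.right_inv y, ← h.symm, h.right_inv, h.left_inv]

theorem norm_inv_le (h : IsPositivePair l L M) (hl : 0 < l) (x : V) : ‖M x‖ ≤ ‖x‖ / l := by
  have h1 := (h.coercive (M x)).trans (real_inner_le_norm _ _)
  rw [h.right_inv] at h1
  rw [le_div_iff₀ hl]
  by_cases h0 : ‖M x‖ = 0
  · rw [h0, zero_mul]; exact norm_nonneg _
  · have hp : 0 < ‖M x‖ := lt_of_le_of_ne (norm_nonneg _) (Ne.symm h0)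
    nlinarith

theorem inner_inv_nonneg (h : IsPositivePair l L M) (hl : 0 < l) (x : V) :
    0 ≤ inner ℝ (M x) x := by
  have := h.coercive (M x)
  rw [h.right_inv, real_inner_comm] at this
  exact (by positivity : 0 ≤ l * ‖M x‖ ^ 2).trans this

theorem inner_inv_le (h : IsPositivePair l L M) (hl : 0 < l) (x : V) :
    inner ℝ (M x) x ≤ ‖x‖ ^ 2 / l := by
  refine (real_inner_le_norm _ _).trans ?_
  calc ‖M x‖ * ‖x‖ ≤ ‖x‖ / l * ‖x‖ :=
        mul_le_mul_of_nonneg_right (h.norm_inv_le hl x) (norm_nonneg _)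
    _ = ‖x‖ ^ 2 / l := by ring

end IsPositivePair

/-- The energy of a state. -/
noncomputable def energy (β : ℝ) (M : V →L[ℝ] V) (x v w : V) : ℝ :=
  (‖x‖ ^ 2 + ‖v‖ ^ 2 + ‖w‖ ^ 2) / 2 + β * inner ℝ (M x) x / 2 + (inner ℝ (M x) x) ^ 2 / 4

/-- The velocity component of the vector field of the beam system. -/
noncomputable def velField (β : ℝ) (L M : V →L[ℝ] V) (x w : V) : V :=
  -L x + L w - (β + inner ℝ (M x) x) • x

theorem coercivity_mul_le_energy {β l : ℝ} {L M : V →L[ℝ] V} (h : IsPositivePair l L M)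
    (hl : 0 < l) (x v w : V) :
    coercivity β l / 2 * (‖x‖ ^ 2 + ‖v‖ ^ 2 + ‖w‖ ^ 2) ≤ energy β M x v w := by
  have h1 := coercivity_mul_le (β := β) (h.inner_inv_nonneg hl x) (h.inner_inv_le hl x)
  have h2 := mul_le_of_le_one_left (sq_nonneg ‖v‖) (coercivity_le_one (β := β) hl)
  have h3 := mul_le_of_le_one_left (sq_nonneg ‖w‖) (coercivity_le_one (β := β) hl)
  unfold energy
  linarith only [h1, h2, h3, sq_nonneg (inner ℝ (M x) x)]

theorem energy_le_energyBound {β l : ℝ} {L M : V →L[ℝ] V} (h : IsPositivePair l L M)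
    (hl : 0 < l) (x v w : V) :
    energy β M x v w ≤ energyBound β l (‖x‖ ^ 2 + ‖v‖ ^ 2 + ‖w‖ ^ 2) := by
  have hB := one_le_growth (β := β) hl
  have h0 := h.inner_inv_nonneg hl x
  have h1 := mul_le_growth (β := β) h0 (h.inner_inv_le hl x)
  have h2 := mul_le_mul_of_nonneg_right hB (sq_nonneg ‖v‖)
  have h3 := mul_le_mul_of_nonneg_right hB (sq_nonneg ‖w‖)
  have h4 : (inner ℝ (M x) x) ^ 2 ≤ ((‖x‖ ^ 2 + ‖v‖ ^ 2 + ‖w‖ ^ 2) / l) ^ 2 := by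
    refine pow_le_pow_left₀ h0 ((h.inner_inv_le hl x).trans ?_) 2
    gcongr
    linarith only [sq_nonneg ‖v‖, sq_nonneg ‖w‖]
  have h5 : ((‖x‖ ^ 2 + ‖v‖ ^ 2 + ‖w‖ ^ 2) / l) ^ 2 =
    4 * ((‖x‖ ^ 2 + ‖v‖ ^ 2 + ‖w‖ ^ 2) ^ 2 / (4 * l ^ 2)) := by field_simp
  unfold energy energyBound
  rw [h5] at h4
  linarith only [h1, h2, h3, h4]

section Curves

variable {β l : ℝ} {L M : V →L[ℝ] V} {x v w : ℝ → V} {s : Set ℝ} {t : ℝ}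

theorem hasDerivWithinAt_inner_inv (h : IsPositivePair l L M) {x' : V}
    (hx : HasDerivWithinAt x x' s t) :
    HasDerivWithinAt (fun t => inner ℝ (M (x t)) (x t)) (2 * inner ℝ (M (x t)) x') s t := by
  have hM := M.hasFDerivAt.comp_hasDerivWithinAt t hx
  refine (hM.inner ℝ hx).congr_deriv ?_
  rw [h.symm_inv x', real_inner_comm (M (x t)) x', two_mul, Function.comp_apply]

/-- Along the (time-scaled) beam system the energy is dissipated by the temperature. -/
theorem hasDerivWithinAt_energy (h : IsPositivePair l L M) {c : ℝ}
    (hx : HasDerivWithinAt x (c • L (v t)) s t)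
    (hv : HasDerivWithinAt v (c • velField β L M (x t) (w t)) s t)
    (hw : HasDerivWithinAt w (c • (-L (w t) - L (v t))) s t) :
    HasDerivWithinAt (fun t => energy β M (x t) (v t) (w t))
      (-(c * inner ℝ (L (w t)) (w t))) s t := by
  have hp := hasDerivWithinAt_inner_inv h hx
  have := (((hx.norm_sq.add hv.norm_sq).add hw.norm_sq).div_const 2).add
    ((hp.const_mul β).div_const 2) |>.add ((hp.pow 2).div_const 4)
  refine this.congr_deriv ?_
  -- By symmetry of `L` all couplings cancel. Since `M` inverts `L`, the potential terms change at
  -- the rate (β + p)⟪x, v⟫, which cancels the work of the force.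
  have e1 : inner ℝ (M (x t)) (L (v t)) = inner ℝ (x t) (v t) := by
    rw [h.symm_inv, h.left_inv]
  have e2 : inner ℝ (v t) (L (x t)) = inner ℝ (x t) (L (v t)) := by
    rw [← h.symm, real_inner_comm]
  have e3 : inner ℝ (w t) (L (v t)) = inner ℝ (v t) (L (w t)) := by
    rw [← h.symm, real_inner_comm]
  simp only [velField, inner_smul_right, inner_add_right, inner_sub_right, inner_neg_right, e1,
    e2, e3, real_inner_comm (x t) (v t), real_inner_comm (w t) (L (w t))]
  push_cast
  ring

/-- The multiplier functional of the Lyapunov argument. -/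
noncomputable def multiplier (M : V →L[ℝ] V) (x v w : V) : ℝ :=
  inner ℝ (M x) v + 2 * inner ℝ (M w) v

/-- The part ⟪M x, v⟫ yields -‖x‖² but also +‖v‖²; the weight 2 on ⟪M w, v⟫ contributes -2‖v‖² and
reverses the sign. No `L` remains, because it always meets its inverse `M`. -/
theorem hasDerivWithinAt_multiplier (h : IsPositivePair l L M)
    (hx : HasDerivWithinAt x (L (v t)) s t)
    (hv : HasDerivWithinAt v (velField β L M (x t) (w t)) s t)
    (hw : HasDerivWithinAt w (-L (w t) - L (v t)) s t) :
    HasDerivWithinAt (fun t => multiplier M (x t) (v t) (w t))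
      (-‖v t‖ ^ 2 - ‖x t‖ ^ 2 - (β + inner ℝ (M (x t)) (x t)) * inner ℝ (M (x t)) (x t)
        - inner ℝ (x t) (w t) - 2 * inner ℝ (w t) (v t) + 2 * ‖w t‖ ^ 2
        - 2 * ((β + inner ℝ (M (x t)) (x t)) * inner ℝ (M (w t)) (x t))) s t := by
  have hMx := M.hasFDerivAt.comp_hasDerivWithinAt t hx
  have hMw := M.hasFDerivAt.comp_hasDerivWithinAt t hw
  have := (hMx.inner ℝ hv).add ((hMw.inner ℝ hv).const_mul 2)
  refine this.congr_deriv ?_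
  have e : ∀ y z, inner ℝ (M y) (L z) = inner ℝ y z := fun y z => by
    rw [h.symm_inv, h.left_inv]
  simp only [velField, Function.comp_apply, map_sub, map_neg, h.left_inv, inner_smul_right,
    inner_add_right, inner_sub_right, inner_neg_right, inner_sub_left, inner_neg_left, e,
    real_inner_self_eq_norm_sq, real_inner_comm (x t) (w t)]
  ring

theorem abs_multiplier_le (h : IsPositivePair l L M) (hl : 0 < l) (x v w : V) :
    |multiplier M x v w| ≤ 3 / (2 * l) * (‖x‖ ^ 2 + ‖v‖ ^ 2 + ‖w‖ ^ 2) := by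
  have hb : ∀ y, |inner ℝ (M y) v| ≤ ‖y‖ / l * ‖v‖ := fun y =>
    (abs_real_inner_le_norm _ _).trans
      (mul_le_mul_of_nonneg_right (h.norm_inv_le hl y) (norm_nonneg _))
  have h1 := abs_add_le (inner ℝ (M x) v) (2 * inner ℝ (M w) v)
  rw [abs_mul, abs_two] at h1
  have h2 : ‖x‖ / l * ‖v‖ + 2 * (‖w‖ / l * ‖v‖) = (‖x‖ * ‖v‖ + 2 * (‖w‖ * ‖v‖)) / l := by ring
  have h3 : 3 / (2 * l) * (‖x‖ ^ 2 + ‖v‖ ^ 2 + ‖w‖ ^ 2) =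
    (3 / 2 * (‖x‖ ^ 2 + ‖v‖ ^ 2 + ‖w‖ ^ 2)) / l := by field_simp
  rw [h3]
  refine (h1.trans (add_le_add (hb x) (mul_le_mul_of_nonneg_left (hb w) zero_le_two))).trans ?_
  rw [h2]
  gcongr
  linarith only [sq_nonneg (‖x‖ - ‖v‖), sq_nonneg (‖w‖ - ‖v‖), sq_nonneg ‖x‖, sq_nonneg ‖w‖]

/-- Exponential decay along solutions of the beam system with bounded operators. -/
theorem sq_norm_le_of_solution (h : IsPositivePair l L M) (hl : 0 < l) (hβ : -l < β)
    (hx : ∀ t, 0 ≤ t → HasDerivWithinAt x (L (v t)) (Ici 0) t)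
    (hv : ∀ t, 0 ≤ t → HasDerivWithinAt v (velField β L M (x t) (w t)) (Ici 0) t)
    (hw : ∀ t, 0 ≤ t → HasDerivWithinAt w (-L (w t) - L (v t)) (Ici 0) t) (ht : 0 ≤ t) :
    ‖x t‖ ^ 2 + ‖v t‖ ^ 2 + ‖w t‖ ^ 2 ≤
      sqBound β l (‖x 0‖ ^ 2 + ‖v 0‖ ^ 2 + ‖w 0‖ ^ 2) * Real.exp (-sqRate β l * t) := by
  have hg := coercivity_pos hl hβ
  have hε := lyapWeight_pos hl hβ
  have hf := factorRate_pos hl hβ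
  set En : ℝ → ℝ := fun t => energy β M (x t) (v t) (w t) with hEn
  set P : ℝ → ℝ := fun t => multiplier M (x t) (v t) (w t) with hP
  have hEnco : ∀ t, coercivity β l / 2 * (‖x t‖ ^ 2 + ‖v t‖ ^ 2 + ‖w t‖ ^ 2) ≤ En t :=
    fun t => coercivity_mul_le_energy h hl _ _ _
  have hEn0 : ∀ t, 0 ≤ En t := fun t =>
    le_trans (by positivity) (hEnco t)
  have hPE : ∀ t, |lyapWeight β l * P t| ≤ En t / 2 := by
    intro t
    have h1 := abs_multiplier_le h hl (x t) (v t) (w t)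
    have h2 : 3 / (2 * l) * (‖x t‖ ^ 2 + ‖v t‖ ^ 2 + ‖w t‖ ^ 2) = 3 / (coercivity β l * l) *
      (coercivity β l / 2 * (‖x t‖ ^ 2 + ‖v t‖ ^ 2 + ‖w t‖ ^ 2)) := by field_simp
    rw [h2] at h1
    have h3 : |P t| ≤ 3 / (coercivity β l * l) * En t :=
      h1.trans (mul_le_mul_of_nonneg_left (hEnco t) (by positivity))
    rw [abs_mul, abs_of_pos hε]
    calc _ ≤ lyapWeight β l * (3 / (coercivity β l * l) * En t) :=
          mul_le_mul_of_nonneg_left h3 hε.le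
      _ = lyapWeight β l * (3 / (coercivity β l * l)) * En t := by ring
      _ ≤ 1 / 2 * En t := mul_le_mul_of_nonneg_right (lyapWeight_mul_le hl hβ) (hEn0 t)
      _ = _ := by ring
  set W : ℝ → ℝ := fun t => En t + lyapWeight β l * P t with hW
  have hWlow : ∀ t, En t / 2 ≤ W t := fun t => by
    have := (abs_le.1 (hPE t)).1; simp only [hW]; linarith
  have hWup : ∀ t, W t ≤ 3 / 2 * En t := fun t => by
    have := (abs_le.1 (hPE t)).2; simp only [hW]; linarith
  have hdE : ∀ t, 0 ≤ t → HasDerivWithinAt En (-inner ℝ (L (w t)) (w t)) (Ici 0) t :=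
    fun t ht => by
      have := hasDerivWithinAt_energy (β := β) (c := 1) h (by simpa using hx t ht)
        (by simpa using hv t ht) (by simpa using hw t ht)
      simpa using this
  have hdP := fun t ht => hasDerivWithinAt_multiplier h (hx t ht) (hv t ht) (hw t ht)
  have hdW := fun t ht => (hdE t ht).add ((hdP t ht).const_mul (lyapWeight β l))
  have hD0 : ∀ t, 0 ≤ inner ℝ (L (w t)) (w t) := fun t =>
    (by positivity : 0 ≤ l * ‖w t‖ ^ 2).trans (h.coercive _)
  -- The exponential is the integrating factor: as E' = -D it contributes `-factorRate * D * W`,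
  -- which absorbs the E·D remainder of `lyapunov_core` because E ≤ 2W.
  have hd := fun t ht => (hdW t ht).mul ((hdE t ht).const_mul (factorRate β l)).exp
  have hmain := le_mul_exp_of_deriv_le (c := -sqRate β l) hd (fun t ht => ?_) ht
  · have hexp1 : 1 ≤ Real.exp (factorRate β l * En t) :=
      Real.one_le_exp (mul_nonneg hf.le (hEn0 t))
    have hE0 : En 0 ≤ energyBound β l (‖x 0‖ ^ 2 + ‖v 0‖ ^ 2 + ‖w 0‖ ^ 2) :=
      energy_le_energyBound h hl _ _ _
    have hW0 : 0 ≤ W t := (by have := hEn0 t; positivity : 0 ≤ En t / 2).trans (hWlow t)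
    have h1 : W t ≤ W 0 * Real.exp (factorRate β l * En 0) * Real.exp (-sqRate β l * t) :=
      (le_mul_of_one_le_right hW0 hexp1).trans hmain
    have h2 : W 0 * Real.exp (factorRate β l * En 0) ≤
        3 / 2 * (energyBound β l (‖x 0‖ ^ 2 + ‖v 0‖ ^ 2 + ‖w 0‖ ^ 2) *
        Real.exp (factorRate β l * energyBound β l (‖x 0‖ ^ 2 + ‖v 0‖ ^ 2 + ‖w 0‖ ^ 2))) := by
      rw [← mul_assoc]
      have h3 := hEn0 0
      exact mul_le_mul ((hWup 0).trans (by linarith))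
        (Real.exp_le_exp.2 (mul_le_mul_of_nonneg_left hE0 hf.le)) (Real.exp_pos _).le
        (by linarith)
    have h3 := mul_le_mul_of_nonneg_right h2 (Real.exp_pos (-sqRate β l * t)).le
    have h4 : coercivity β l / 4 * (‖x t‖ ^ 2 + ‖v t‖ ^ 2 + ‖w t‖ ^ 2) ≤ W t := by
      have := hEnco t; have := hWlow t; linarith
    have h5 := (h4.trans h1).trans h3
    have h6 := mul_le_mul_of_nonneg_left h5 (by positivity : 0 ≤ 4 / coercivity β l)
    rw [← mul_assoc, show 4 / coercivity β l * (coercivity β l / 4) = 1 by field_simp,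
      one_mul] at h6
    refine h6.trans_eq ?_
    unfold sqBound
    ring
  · have hcore := lyapunov_core hl hβ (h.inner_inv_nonneg hl (x t)) (h.inner_inv_le hl (x t))
      (h.coercive (w t)) (abs_real_inner_le_norm (x t) (w t)) (abs_real_inner_le_norm (w t) (v t))
      (r := inner ℝ (M (w t)) (x t))
      ((abs_real_inner_le_norm _ _).trans ((mul_le_mul_of_nonneg_right
        (h.norm_inv_le hl (w t)) (norm_nonneg _)).trans_eq (by ring)))
      (En := En t) rfl
    have hexp := (Real.exp_pos (factorRate β l * En t)).le
    have hB : 0 < growth β l := one_pos.trans_le (one_le_growth hl)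
    -- The comparison W ≤ (3/2)E is the source of the factor 2/3 in `sqRate`.
    have hk : -(lyapWeight β l * coercivity β l / growth β l) * En t ≤ -(sqRate β l * W t) := by
      have := mul_le_mul_of_nonneg_left (hWup t)
        (by positivity : 0 ≤ lyapWeight β l * coercivity β l / growth β l)
      unfold sqRate
      linarith
    have hc : lyapWeight β l * (4 / (coercivity β l * l ^ 3)) *
        (En t * inner ℝ (L (w t)) (w t)) ≤ factorRate β l * (W t * inner ℝ (L (w t)) (w t)) := by
      have h1 := mul_le_mul_of_nonneg_right (hWlow t) (hD0 t)
      have h2 := mul_le_mul_of_nonneg_left h1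
        (by positivity : 0 ≤ lyapWeight β l * (4 / (coercivity β l * l ^ 3)))
      unfold factorRate
      linarith
    have hfin := mul_le_mul_of_nonneg_right (hcore.trans
      (add_le_add hk hc)) hexp
    have hWt : W t = En t + lyapWeight β l * multiplier M (x t) (v t) (w t) := rfl
    rw [hWt] at hfin
    simp only [Pi.add_apply, Pi.mul_apply]
    linarith only [hfin]

end Curves

end FiniteDimensional

-- Global solvability in finite dimensions

section FiniteDimensionalExistence

variable {V : Type*} [NormedAddCommGroup V] [InnerProductSpace ℝ V] [FiniteDimensional ℝ V]

/-- Multiplying a smooth field by a cutoff makes it globally solvable. -/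
theorem exists_cutoff_solution {S : Type*} [NormedAddCommGroup S] [NormedSpace ℝ S]
    [FiniteDimensional ℝ S] {F : S → S} (hF : ContDiff ℝ 1 F) {r : ℝ} (hr : 0 < r) (y₀ : S) :
    ∃ (c : ℝ → ℝ) (y : ℝ → S), (∀ t, 0 ≤ c t) ∧ (∀ t, ‖y t‖ ≤ r → c t = 1) ∧ y 0 = y₀ ∧
      ∀ t, 0 ≤ t → HasDerivWithinAt y (c t • F (y t)) (Ici 0) t := by
  have : CompleteSpace S := FiniteDimensional.complete ℝ S
  let χ : ContDiffBump (0 : S) := ⟨r, r + 1, hr, by linarith⟩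
  have hχF : ContDiff ℝ 1 (fun y => χ y • F y) := χ.contDiff.smul hF
  have hsupp : HasCompactSupport (fun y => χ y • F y) := χ.hasCompactSupport.smul_right
  obtain ⟨K, hK⟩ := hχF.lipschitzWith_of_hasCompactSupport hsupp (by simp)
  obtain ⟨C, hC⟩ := hsupp.exists_bound_of_continuous hχF.continuous
  obtain ⟨y, hy0, hy⟩ := exists_forward_solution (C := C.toNNReal) hK
    (fun y => (hC y).trans (Real.le_coe_toNNReal C)) y₀
  exact ⟨fun t => χ (y t), y, fun t => χ.nonneg,
    fun t ht => χ.one_of_mem_closedBall (by simpa using ht), hy0, hy⟩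

/-- The beam system with bounded operators on a finite-dimensional space is globally solvable. -/
theorem exists_finiteDimensional_solution {β l : ℝ} {L M : V →L[ℝ] V} (h : IsPositivePair l L M)
    (hl : 0 < l) (hβ : -l < β) (x₀ v₀ w₀ : V) :
    ∃ x v w : ℝ → V, x 0 = x₀ ∧ v 0 = v₀ ∧ w 0 = w₀ ∧
      (∀ t, 0 ≤ t → HasDerivWithinAt x (L (v t)) (Ici 0) t) ∧
      (∀ t, 0 ≤ t → HasDerivWithinAt v (velField β L M (x t) (w t)) (Ici 0) t) ∧
      (∀ t, 0 ≤ t → HasDerivWithinAt w (-L (w t) - L (v t)) (Ici 0) t) := by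
  have hg := coercivity_pos hl hβ
  set F : V × V × V → V × V × V :=
    fun y => (L y.2.1, velField β L M y.1 y.2.2, -L y.2.2 - L y.2.1) with hF
  have hFc : ContDiff ℝ 1 F := by
    refine ContDiff.prodMk (by fun_prop) (ContDiff.prodMk ?_ (by fun_prop))
    have : ContDiff ℝ 1 fun y : V × V × V => inner ℝ (M y.1) y.1 :=
      ContDiff.inner ℝ (by fun_prop) (by fun_prop)
    unfold velField
    fun_prop
  -- By coercivity `ρ` bounds the squared norm wherever the energy does not exceed its initial
  -- value; the cutoff equals 1 on a ball containing all such states.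
  set ρ : ℝ := 2 / coercivity β l * energy β M x₀ v₀ w₀ with hρ
  obtain ⟨c, y, hc0, hc1, hy0, hy⟩ := exists_cutoff_solution hFc
    (r := √ρ + 1) (by positivity) (x₀, v₀, w₀)
  have hx : ∀ t, 0 ≤ t → HasDerivWithinAt (fun t => (y t).1) (c t • L (y t).2.1) (Ici 0) t :=
    fun t ht => (ContinuousLinearMap.fst ℝ V (V × V)).hasFDerivAt.comp_hasDerivWithinAt t (hy t ht)
  have hv : ∀ t, 0 ≤ t → HasDerivWithinAt (fun t => (y t).2.1)
      (c t • velField β L M (y t).1 (y t).2.2) (Ici 0) t := fun t ht =>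
    ((ContinuousLinearMap.fst ℝ V V).comp
      (ContinuousLinearMap.snd ℝ V (V × V))).hasFDerivAt.comp_hasDerivWithinAt t (hy t ht)
  have hw : ∀ t, 0 ≤ t → HasDerivWithinAt (fun t => (y t).2.2)
      (c t • (-L (y t).2.2 - L (y t).2.1)) (Ici 0) t := fun t ht =>
    ((ContinuousLinearMap.snd ℝ V V).comp
      (ContinuousLinearMap.snd ℝ V (V × V))).hasFDerivAt.comp_hasDerivWithinAt t (hy t ht)
  have hE : ∀ t, 0 ≤ t → HasDerivWithinAt (fun t => energy β M (y t).1 (y t).2.1 (y t).2.2)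
      (-(c t * inner ℝ (L (y t).2.2) (y t).2.2)) (Ici 0) t := fun t ht =>
    hasDerivWithinAt_energy (x := fun t => (y t).1) (v := fun t => (y t).2.1)
      (w := fun t => (y t).2.2) h (hx t ht) (hv t ht) (hw t ht)
  -- The cutoff only multiplies the field by a nonnegative scalar, so the energy is nonincreasing
  -- even before `c t = 1` is known.
  have hle : ∀ t, 0 ≤ t → energy β M (y t).1 (y t).2.1 (y t).2.2 ≤ energy β M x₀ v₀ w₀ := by
    intro t ht
    have := le_mul_exp_of_deriv_le (c := 0) hE (fun t _ => by
      have h1 := (by positivity : 0 ≤ l * ‖(y t).2.2‖ ^ 2).trans (h.coercive (y t).2.2)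
      have := mul_nonneg (hc0 t) h1
      simpa using this) ht
    simpa [hy0] using this
  have hbd : ∀ t, 0 ≤ t → c t = 1 := by
    intro t ht
    refine hc1 t ?_
    have h1 := (coercivity_mul_le_energy (β := β) h hl _ _ _).trans (hle t ht)
    have h2 := mul_le_mul_of_nonneg_left h1 (by positivity : 0 ≤ 2 / coercivity β l)
    rw [← mul_assoc, show 2 / coercivity β l * (coercivity β l / 2) = 1 by field_simp, one_mul,
      ← hρ] at h2
    have hb : ∀ z : V, ‖z‖ ^ 2 ≤ ρ → ‖z‖ ≤ √ρ + 1 := fun z hz =>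
      (Real.le_sqrt_of_sq_le hz).trans (by linarith)
    have p1 := sq_nonneg ‖(y t).1‖
    have p2 := sq_nonneg ‖(y t).2.1‖
    have p3 := sq_nonneg ‖(y t).2.2‖
    refine max_le (hb _ (by linarith)) (max_le (hb _ (by linarith)) (hb _ (by linarith)))
  refine ⟨fun t => (y t).1, fun t => (y t).2.1, fun t => (y t).2.2, by simp [hy0], by simp [hy0],
    by simp [hy0], fun t ht => ?_, fun t ht => ?_, fun t ht => ?_⟩
  · have := hx t ht; rw [hbd t ht] at this; simpa [hF] using this
  · have := hv t ht; rw [hbd t ht] at this; simpa [hF] using this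
  · have := hw t ht; rw [hbd t ht] at this; simpa [hF] using this

end FiniteDimensionalExistence

-- Diagonal operators in a Hilbert basis

section Diagonal

variable {ι : Type*} {H : Type*} [NormedAddCommGroup H] [InnerProductSpace ℝ H]

theorem hilbertBasis_ext (b : HilbertBasis ι ℝ H) {x y : H}
    (h : ∀ i, inner ℝ (b i) x = inner ℝ (b i) y) : x = y := by
  apply b.repr.injective
  ext i
  rw [b.repr_apply_apply, b.repr_apply_apply, h]

theorem hasSum_sq_inner (b : HilbertBasis ι ℝ H) (x : H) :
    HasSum (fun i => inner ℝ (b i) x ^ 2) (‖x‖ ^ 2) := by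
  have := b.hasSum_inner_mul_inner x x
  rw [real_inner_self_eq_norm_sq] at this
  refine this.congr_fun ?_
  intro i
  rw [real_inner_comm x, sq]

/-- `D` is the diagonal operator with entries `a` in the basis `b`. -/
def IsDiagonal (b : HilbertBasis ι ℝ H) (a : ι → ℝ) (D : H →L[ℝ] H) : Prop :=
  ∀ i x, inner ℝ (b i) (D x) = a i * inner ℝ (b i) x

/-- Multiplication by a bounded sequence is bounded on ℓ²; the operator is its conjugate by the
coordinate isometry. -/
theorem exists_isDiagonal (b : HilbertBasis ι ℝ H) {a : ι → ℝ} {C : ℝ}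
    (ha : ∀ i, |a i| ≤ C) (hC : 0 ≤ C) : ∃ D : H →L[ℝ] H, IsDiagonal b a D := by
  have hle : ∀ (x : lp (fun _ : ι => ℝ) 2) i, ‖a i * x i‖ ^ 2 ≤ C ^ 2 * ‖x i‖ ^ 2 := by
    intro x i
    rw [norm_mul, mul_pow]
    exact mul_le_mul_of_nonneg_right (pow_le_pow_left₀ (abs_nonneg _) (ha i) 2) (sq_nonneg _)
  have hsum : ∀ x : lp (fun _ : ι => ℝ) 2, Summable fun i => ‖x i‖ ^ 2 := fun x => by
    simpa using (lp.memℓp x).summable (by simp)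
  have hmem : ∀ x : lp (fun _ : ι => ℝ) 2, Memℓp (fun i => a i * x i) 2 := fun x =>
    memℓp_gen (by
      simpa using Summable.of_nonneg_of_le (fun i => sq_nonneg ‖a i * x i‖) (hle x)
        ((hsum x).mul_left (C ^ 2)))
  let T : lp (fun _ : ι => ℝ) 2 →ₗ[ℝ] lp (fun _ : ι => ℝ) 2 :=
    { toFun := fun x => ⟨fun i => a i * x i, hmem x⟩
      map_add' := fun x y => by ext i; exact mul_add _ _ _
      map_smul' := fun c x => by
        ext i
        change a i * (c * x i) = c * (a i * x i)
        ring }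
  have hT : ∀ x, ‖T x‖ ≤ C * ‖x‖ := by
    intro x
    have h2 : (2 : ℝ≥0∞).toReal = 2 := by simp
    have h1 : ∀ y : lp (fun _ : ι => ℝ) 2, ‖y‖ ^ 2 = ∑' i, ‖y i‖ ^ 2 := fun y => by
      have := lp.norm_rpow_eq_tsum (p := 2) (by simp) y
      simpa using this
    refine le_of_sq_le_sq ?_ (by positivity)
    rw [mul_pow, h1, h1, ← tsum_mul_left]
    exact (hsum (T x)).tsum_le_tsum (hle x) ((hsum x).mul_left _)
  refine ⟨(b.repr.symm.toContinuousLinearEquiv : _ →L[ℝ] H).comp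
    ((T.mkContinuous C hT).comp (b.repr.toContinuousLinearEquiv : H →L[ℝ] _)), fun i x => ?_⟩
  rw [← b.repr_apply_apply, ← b.repr_apply_apply]
  simp [T]

namespace IsDiagonal

variable {b : HilbertBasis ι ℝ H} {a : ι → ℝ} {D : H →L[ℝ] H}

theorem apply_basis (h : IsDiagonal b a D) (i : ι) : D (b i) = a i • b i := by
  classical
  refine hilbertBasis_ext b fun j => ?_
  rw [h, inner_smul_right, orthonormal_iff_ite.1 b.orthonormal]
  split_ifs with hij
  · rw [hij]
  · simp

theorem symm (h : IsDiagonal b a D) (x y : H) : inner ℝ (D x) y = inner ℝ x (D y) := by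
  rw [← b.tsum_inner_mul_inner, ← b.tsum_inner_mul_inner]
  refine tsum_congr fun i => ?_
  rw [h, real_inner_comm (b i), h, real_inner_comm x]
  ring

theorem hasSum_inner (h : IsDiagonal b a D) (x : H) :
    HasSum (fun i => a i * inner ℝ (b i) x ^ 2) (inner ℝ (D x) x) := by
  have := b.hasSum_inner_mul_inner (D x) x
  refine this.congr_fun fun i => ?_
  rw [real_inner_comm (b i) (D x), h]
  ring

theorem mul_le_inner (h : IsDiagonal b a D) {c : ℝ} (ha : ∀ i, c ≤ a i) (x : H) :
    c * ‖x‖ ^ 2 ≤ inner ℝ (D x) x :=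
  hasSum_le (fun i => mul_le_mul_of_nonneg_right (ha i) (sq_nonneg _))
    ((hasSum_sq_inner b x).mul_left c) (h.hasSum_inner x)

theorem norm_le (h : IsDiagonal b a D) {C : ℝ} (hC : 0 ≤ C) (ha : ∀ i, |a i| ≤ C) (x : H) :
    ‖D x‖ ≤ C * ‖x‖ := by
  refine abs_le_of_sq_le_sq' ?_ (by positivity) |>.2
  rw [mul_pow]
  refine hasSum_le (fun i => ?_) (hasSum_sq_inner b (D x))
    ((hasSum_sq_inner b x).mul_left _)
  rw [h, mul_pow, ← sq_abs (a i)]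
  exact mul_le_mul_of_nonneg_right (pow_le_pow_left₀ (abs_nonneg _) (ha i) 2) (sq_nonneg _)

theorem comp_apply {a' : ι → ℝ} {D' D'' : H →L[ℝ] H} (h : IsDiagonal b a D)
    (h' : IsDiagonal b a' D') (h'' : IsDiagonal b (fun i => a i * a' i) D'') (x : H) :
    D (D' x) = D'' x :=
  hilbertBasis_ext b fun i => by rw [h, h', h'', mul_assoc]

end IsDiagonal

/-- A diagonal operator on a finite-dimensional space and its inverse. -/
theorem exists_isPositivePair {ι V : Type*} [Fintype ι] [NormedAddCommGroup V]
    [InnerProductSpace ℝ V] (b : HilbertBasis ι ℝ V) {ℓ : ι → ℝ} {l : ℝ} (hl : 0 < l)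
    (hℓ : ∀ i, l ≤ ℓ i) : ∃ L M : V →L[ℝ] V, IsPositivePair l L M ∧ IsDiagonal b ℓ L ∧
      IsDiagonal b (fun i => (ℓ i)⁻¹) M := by
  have hpos : ∀ i, 0 < ℓ i := fun i => hl.trans_le (hℓ i)
  obtain ⟨L, hL⟩ := exists_isDiagonal b (a := ℓ) (C := ∑ i, |ℓ i|)
    (fun i => Finset.single_le_sum (f := fun i => |ℓ i|) (fun _ _ => abs_nonneg _)
      (Finset.mem_univ i)) (Finset.sum_nonneg fun _ _ => abs_nonneg _)
  obtain ⟨M, hM⟩ := exists_isDiagonal b (a := fun i => (ℓ i)⁻¹) (C := l⁻¹)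
    (fun i => by
      rw [abs_of_pos (inv_pos.2 (hpos i))]
      exact inv_anti₀ hl (hℓ i)) (by positivity)
  refine ⟨L, M, ⟨fun x => ?_, fun x => ?_, hL.symm, hL.mul_le_inner hℓ⟩, hL, hM⟩
  · refine hilbertBasis_ext b fun i => ?_
    rw [hM, hL, ← mul_assoc, inv_mul_cancel₀ (hpos i).ne', one_mul]
  · refine hilbertBasis_ext b fun i => ?_
    rw [hL, hM, ← mul_assoc, mul_inv_cancel₀ (hpos i).ne', one_mul]

end Diagonal

-- The squared norm on H × H × H

section Triples

variable {H : Type*} [NormedAddCommGroup H]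

/-- The squared norm of a triple. -/
def triSq (x v w : H) : ℝ := ‖x‖ ^ 2 + ‖v‖ ^ 2 + ‖w‖ ^ 2

theorem triSq_nonneg (x v w : H) : 0 ≤ triSq x v w := by unfold triSq; positivity

theorem norm_le_sqrt_triSq (x v w : H) :
    ‖x‖ ≤ √(triSq x v w) ∧ ‖v‖ ≤ √(triSq x v w) ∧ ‖w‖ ≤ √(triSq x v w) := by
  have h1 := sq_nonneg ‖x‖
  have h2 := sq_nonneg ‖v‖
  have h3 := sq_nonneg ‖w‖
  refine ⟨Real.le_sqrt_of_sq_le ?_, Real.le_sqrt_of_sq_le ?_, Real.le_sqrt_of_sq_le ?_⟩ <;>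
  · unfold triSq; linarith

end Triples

-- Fourier modes, continuous dependence and uniqueness

section Modes

variable {ι : Type*} {H : Type*} [NormedAddCommGroup H] [InnerProductSpace ℝ H]

/-- The nonlinear force `(β + ⟪M x, x⟫) x`. -/
noncomputable def force (β : ℝ) (M : H →L[ℝ] H) (x : H) : H := (β + inner ℝ (M x) x) • x

/-- The Lipschitz constant of the force on a ball of radius `R`. -/
noncomputable def forceLip (β l R : ℝ) : ℝ := |β| + 3 * R ^ 2 / l

theorem forceLip_nonneg {β l R : ℝ} (hl : 0 < l) : 0 ≤ forceLip β l R := by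
  unfold forceLip; positivity

/-- The cubic part is trilinear, so its difference telescopes into three terms with one factor `x -
y` each; hence the 3 in `forceLip`. -/
theorem norm_force_sub_le {β l R : ℝ} (hl : 0 < l) {M : H →L[ℝ] H}
    (hM : ∀ x, ‖M x‖ ≤ l⁻¹ * ‖x‖) {x y : H} (hx : ‖x‖ ≤ R) (hy : ‖y‖ ≤ R) :
    ‖force β M x - force β M y‖ ≤ forceLip β l R * ‖x - y‖ := by
  have hR : 0 ≤ R := (norm_nonneg _).trans hx
  have key : ∀ a b : H, |inner ℝ (M a) b| ≤ l⁻¹ * ‖a‖ * ‖b‖ := fun a b =>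
    (abs_real_inner_le_norm _ _).trans (mul_le_mul_of_nonneg_right (hM a) (norm_nonneg _))
  have e : force β M x - force β M y = β • (x - y) + inner ℝ (M x) x • (x - y) +
      (inner ℝ (M (x - y)) x + inner ℝ (M y) (x - y)) • y := by
    simp only [force, map_sub, inner_sub_left, inner_sub_right, smul_sub, add_smul, sub_smul]
    abel
  have hd := norm_nonneg (x - y)
  have h1 : |inner ℝ (M x) x| ≤ l⁻¹ * R * R := (key x x).trans (by gcongr)
  have h2 : |inner ℝ (M (x - y)) x| ≤ l⁻¹ * ‖x - y‖ * R := (key _ _).trans (by gcongr)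
  have h3 : |inner ℝ (M y) (x - y)| ≤ l⁻¹ * R * ‖x - y‖ := (key _ _).trans (by gcongr)
  rw [e]
  refine (norm_add₃_le).trans ?_
  rw [norm_smul, norm_smul, norm_smul, Real.norm_eq_abs, Real.norm_eq_abs, Real.norm_eq_abs]
  have h4 : |inner ℝ (M (x - y)) x + inner ℝ (M y) (x - y)| * ‖y‖ ≤
      (l⁻¹ * ‖x - y‖ * R + l⁻¹ * R * ‖x - y‖) * R :=
    mul_le_mul ((abs_add_le _ _).trans (add_le_add h2 h3)) hy (norm_nonneg _) (by positivity)
  have h5 := mul_le_mul_of_nonneg_right h1 hd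
  have h6 : forceLip β l R * ‖x - y‖ = |β| * ‖x - y‖ + l⁻¹ * R * R * ‖x - y‖ +
    (l⁻¹ * ‖x - y‖ * R + l⁻¹ * R * ‖x - y‖) * R := by
    unfold forceLip; ring
  rw [h6]
  linarith

/-- Continuous curves whose Fourier modes solve the beam system. -/
structure IsModeSolution (b : HilbertBasis ι ℝ H) (ℓ : ι → ℝ) (M : H →L[ℝ] H) (β : ℝ)
    (x v w : ℝ → H) : Prop where
  contX : ContinuousOn x (Ici 0)
  contV : ContinuousOn v (Ici 0)
  contW : ContinuousOn w (Ici 0)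
  derivX : ∀ i t, 0 ≤ t → HasDerivWithinAt (fun s => inner ℝ (b i) (x s))
    (ℓ i * inner ℝ (b i) (v t)) (Ici 0) t
  derivV : ∀ i t, 0 ≤ t → HasDerivWithinAt (fun s => inner ℝ (b i) (v s))
    (-(ℓ i * inner ℝ (b i) (x t)) + ℓ i * inner ℝ (b i) (w t) -
      inner ℝ (b i) (force β M (x t))) (Ici 0) t
  derivW : ∀ i t, 0 ≤ t → HasDerivWithinAt (fun s => inner ℝ (b i) (w s))
    (-(ℓ i * inner ℝ (b i) (w t)) - ℓ i * inner ℝ (b i) (v t)) (Ici 0) t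

/-- The growth rate of the squared distance of two solutions in a ball of radius `R`. -/
noncomputable def splitRate (β l R : ℝ) : ℝ := 1 + forceLip β l R ^ 2

/-- Continuous dependence on the initial data. -/
theorem IsModeSolution.triSq_sub_le {b : HilbertBasis ι ℝ H} {ℓ : ι → ℝ} {M : H →L[ℝ] H}
    {β l R T : ℝ} {x v w x' v' w' : ℝ → H} (hl : 0 < l) (hℓ : ∀ i, 0 ≤ ℓ i)
    (hM : ∀ x, ‖M x‖ ≤ l⁻¹ * ‖x‖) (h : IsModeSolution b ℓ M β x v w)
    (h' : IsModeSolution b ℓ M β x' v' w') (hx : ∀ t ∈ Icc 0 T, ‖x t‖ ≤ R)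
    (hx' : ∀ t ∈ Icc 0 T, ‖x' t‖ ≤ R) {t : ℝ} (ht : t ∈ Icc 0 T) :
    triSq (x t - x' t) (v t - v' t) (w t - w' t) ≤
      triSq (x 0 - x' 0) (v 0 - v' 0) (w 0 - w' 0) * Real.exp (splitRate β l R * t) := by
  set φ : ℝ → ℝ := fun t => triSq (x t - x' t) (v t - v' t) (w t - w' t) with hφ
  have hφc : ContinuousOn φ (Ici 0) :=
    (((h.contX.sub h'.contX).norm.pow 2).add ((h.contV.sub h'.contV).norm.pow 2)).add
      ((h.contW.sub h'.contW).norm.pow 2)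
  have hc0 : 0 ≤ splitRate β l R := by unfold splitRate; positivity
  refine le_mul_exp_of_le_integral (φ := φ) hc0 hφc (fun t ht => ?_) ht
  have hsum : ∀ t, HasSum (fun i => inner ℝ (b i) (x t - x' t) ^ 2 +
      inner ℝ (b i) (v t - v' t) ^ 2 + inner ℝ (b i) (w t - w' t) ^ 2) (φ t) := fun t =>
    ((hasSum_sq_inner b _).add (hasSum_sq_inner b _)).add (hasSum_sq_inner b _)
  -- Only individual modes are known to be differentiable, so the bound is proved for finite sums of
  -- modes, with a right-hand side independent of `J`.
  refine hasSum_le_of_sum_le (hsum t) fun J => ?_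
  -- In `r` the couplings through `ℓ i` have already cancelled; what remains is the force and a
  -- nonpositive dissipation, so the estimate is insensitive to the size of `ℓ`.
  set r : ℝ → ι → ℝ := fun t i =>
    2 * inner ℝ (b i) (v t - v' t) *
      -inner ℝ (b i) (force β M (x t) - force β M (x' t)) -
    2 * (ℓ i * inner ℝ (b i) (w t - w' t) ^ 2) with hr
  have hd : ∀ t, 0 ≤ t → HasDerivWithinAt (fun t => ∑ i ∈ J, (inner ℝ (b i) (x t - x' t) ^ 2 +
      inner ℝ (b i) (v t - v' t) ^ 2 + inner ℝ (b i) (w t - w' t) ^ 2))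
      (∑ i ∈ J, r t i) (Ici 0) t := by
    intro t ht
    refine HasDerivWithinAt.fun_sum fun i _ => ?_
    have d1 := ((h.derivX i t ht).sub (h'.derivX i t ht)).pow 2
    have d2 := ((h.derivV i t ht).sub (h'.derivV i t ht)).pow 2
    have d3 := ((h.derivW i t ht).sub (h'.derivW i t ht)).pow 2
    have := (d1.add d2).add d3
    simp only [inner_sub_right]
    refine this.congr_deriv ?_
    simp only [hr, inner_sub_right, Pi.sub_apply]
    push_cast
    ring
  refine image_le_of_deriv_right_le_deriv_boundary (a := 0) (b := T)
    (fun s hs => (hd s hs.1).continuousWithinAt.mono Icc_subset_Ici_self)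
    (fun s hs => (hd s hs.1).mono (Ici_subset_Ici.2 hs.1))
    (B := fun t => φ 0 + splitRate β l R * ∫ s in (0 : ℝ)..t, φ s)
    (B' := fun s => splitRate β l R * φ s) ?_
    (fun s hs => (((hasDerivWithinAt_integral hφc hs.1).const_mul _).const_add
      (φ 0)).continuousWithinAt.mono Icc_subset_Ici_self)
    (fun s hs => (((hasDerivWithinAt_integral hφc hs.1).const_mul _).const_add
      (φ 0)).mono (Ici_subset_Ici.2 hs.1)) (fun s hs => ?_) ht
  · simp only [intervalIntegral.integral_same, mul_zero, add_zero]
    exact sum_le_hasSum J (fun i _ => by positivity) (hsum 0)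
  · have hs' : s ∈ Icc 0 T := ⟨hs.1, hs.2.le⟩
    have h1 : ∑ i ∈ J, r s i ≤ ∑ i ∈ J, (inner ℝ (b i) (v s - v' s) ^ 2 +
        inner ℝ (b i) (force β M (x s) - force β M (x' s)) ^ 2) := by
      refine Finset.sum_le_sum fun i _ => ?_
      have := mul_nonneg (hℓ i) (sq_nonneg (inner ℝ (b i) (w s - w' s)))
      simp only [hr]
      linarith [sq_nonneg (inner ℝ (b i) (v s - v' s) +
        inner ℝ (b i) (force β M (x s) - force β M (x' s)))]
    have h2 := sum_le_hasSum J (fun i _ => by positivity) ((hasSum_sq_inner b (v s - v' s)).add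
      (hasSum_sq_inner b (force β M (x s) - force β M (x' s))))
    have h3 := pow_le_pow_left₀ (norm_nonneg _)
      (norm_force_sub_le (β := β) hl hM (hx s hs') (hx' s hs')) 2
    rw [mul_pow] at h3
    have h4 : splitRate β l R * φ s = φ s + forceLip β l R ^ 2 * φ s := by
      unfold splitRate; ring
    have h5 : forceLip β l R ^ 2 * ‖x s - x' s‖ ^ 2 ≤ forceLip β l R ^ 2 * φ s := by
      refine mul_le_mul_of_nonneg_left ?_ (sq_nonneg _)
      simp only [hφ, triSq]
      linarith [sq_nonneg ‖v s - v' s‖, sq_nonneg ‖w s - w' s‖]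
    have h6 : ‖v s - v' s‖ ^ 2 ≤ φ s := by
      simp only [hφ, triSq]
      linarith [sq_nonneg ‖x s - x' s‖, sq_nonneg ‖w s - w' s‖]
    rw [h4]
    linarith

/-- Mode solutions are determined by their initial state. -/
theorem IsModeSolution.unique {b : HilbertBasis ι ℝ H} {ℓ : ι → ℝ} {M : H →L[ℝ] H}
    {β l : ℝ} {x v w x' v' w' : ℝ → H} (hl : 0 < l) (hℓ : ∀ i, 0 ≤ ℓ i)
    (hM : ∀ x, ‖M x‖ ≤ l⁻¹ * ‖x‖) (h : IsModeSolution b ℓ M β x v w)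
    (h' : IsModeSolution b ℓ M β x' v' w') (hx : x 0 = x' 0) (hv : v 0 = v' 0)
    (hw : w 0 = w' 0) {t : ℝ} (ht : 0 ≤ t) : x t = x' t ∧ v t = v' t ∧ w t = w' t := by
  obtain ⟨R₁, hR₁⟩ := isCompact_Icc.exists_bound_of_continuousOn
    (h.contX.mono (Icc_subset_Ici_self : Icc 0 t ⊆ Ici 0))
  obtain ⟨R₂, hR₂⟩ := isCompact_Icc.exists_bound_of_continuousOn
    (h'.contX.mono (Icc_subset_Ici_self : Icc 0 t ⊆ Ici 0))
  have key := h.triSq_sub_le (R := max R₁ R₂) hl hℓ hM h'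
    (fun s hs => (hR₁ s hs).trans (le_max_left _ _))
    (fun s hs => (hR₂ s hs).trans (le_max_right _ _)) ⟨ht, le_rfl⟩
  rw [hx, hv, hw] at key
  simp only [sub_self, triSq, norm_zero] at key
  have h1 := sq_nonneg ‖x t - x' t‖
  have h2 := sq_nonneg ‖v t - v' t‖
  have h3 := sq_nonneg ‖w t - w' t‖
  refine ⟨?_, ?_, ?_⟩ <;> rw [← sub_eq_zero, ← norm_eq_zero, ← sq_eq_zero_iff] <;> linarith

/-- Solutions of the beam system after applying the bounded operator `M = L⁻¹`. -/
structure IsStrongSolution (M : H →L[ℝ] H) (β : ℝ) (x v w : ℝ → H) : Prop where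
  contX : ContinuousOn x (Ici 0)
  contV : ContinuousOn v (Ici 0)
  contW : ContinuousOn w (Ici 0)
  derivX : ∀ t, 0 ≤ t → HasDerivWithinAt (fun s => M (x s)) (v t) (Ici 0) t
  derivV : ∀ t, 0 ≤ t → HasDerivWithinAt (fun s => M (v s))
    (-x t + w t - M (force β M (x t))) (Ici 0) t
  derivW : ∀ t, 0 ≤ t → HasDerivWithinAt (fun s => M (w s)) (-w t - v t) (Ici 0) t

/-- A Fourier coefficient of `y` is `ℓ i` times that of `M y`, so it inherits the differentiability
of `M y`. -/
theorem IsStrongSolution.isModeSolution {b : HilbertBasis ι ℝ H} {ℓ : ι → ℝ} {M : H →L[ℝ] H}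
    {β : ℝ} {x v w : ℝ → H} (h : IsStrongSolution M β x v w) (hℓ : ∀ i, ℓ i ≠ 0)
    (hM : IsDiagonal b (fun i => (ℓ i)⁻¹) M) : IsModeSolution b ℓ M β x v w := by
  have e : ∀ i y, inner ℝ (b i) y = ℓ i * inner ℝ (b i) (M y) := fun i y => by
    rw [hM, mul_inv_cancel_left₀ (hℓ i)]
  have key : ∀ i {y y' : ℝ → H} {t : ℝ}, HasDerivWithinAt (fun s => M (y s)) (y' t) (Ici 0) t →
      HasDerivWithinAt (fun s => inner ℝ (b i) (y s)) (ℓ i * inner ℝ (b i) (y' t)) (Ici 0) t := by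
    intro i y y' t hy
    have := ((innerSL ℝ (b i)).hasFDerivAt.comp_hasDerivWithinAt t hy).const_mul (ℓ i)
    refine (this.congr_of_eventuallyEq (Eventually.of_forall fun s => ?_) ?_)
    · exact e i (y s)
    · exact e i (y t)
  refine ⟨h.contX, h.contV, h.contW, fun i t ht => key i (h.derivX t ht), fun i t ht => ?_,
    fun i t ht => ?_⟩
  · refine (key i (y' := fun t => -x t + w t - M (force β M (x t))) (h.derivV t ht)).congr_deriv ?_
    rw [inner_sub_right, inner_add_right, inner_neg_right, e i (force β M (x t))]
    ring
  · refine (key i (y' := fun t => -w t - v t) (h.derivW t ht)).congr_deriv ?_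
    rw [inner_sub_right, inner_neg_right]
    ring

end Modes

-- Finite-mode solutions and their limit

section Existence

theorem tendsto_triSq {α H : Type*} [NormedAddCommGroup H] {m : Filter α} {f g h : α → H} {a c d : H}
    (hf : Tendsto f m (𝓝 a)) (hg : Tendsto g m (𝓝 c)) (hh : Tendsto h m (𝓝 d)) :
    Tendsto (fun n => triSq (f n) (g n) (h n)) m (𝓝 (triSq a c d)) :=
  ((hf.norm.pow 2).add (hg.norm.pow 2)).add (hh.norm.pow 2)

variable {ι : Type*} {H : Type*} [NormedAddCommGroup H] [InnerProductSpace ℝ H]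

/-- The partial sum of the Fourier series of `y` over `J`. -/
noncomputable def partialSum (b : HilbertBasis ι ℝ H) (J : Finset ι) (y : H) : H :=
  ∑ i ∈ J, inner ℝ (b i) y • b i

theorem tendsto_partialSum (b : HilbertBasis ι ℝ H) (y : H) :
    Tendsto (fun J => partialSum b J y) atTop (𝓝 y) := by
  have := b.hasSum_repr y
  simp only [b.repr_apply_apply] at this
  exact this

theorem norm_partialSum_le (b : HilbertBasis ι ℝ H) (J : Finset ι) (y : H) :
    ‖partialSum b J y‖ ^ 2 ≤ ‖y‖ ^ 2 := by
  rw [← real_inner_self_eq_norm_sq, partialSum, b.orthonormal.inner_sum]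
  refine (Finset.sum_congr rfl fun i _ => ?_).trans_le
    (sum_le_hasSum J (fun i _ => sq_nonneg _) (hasSum_sq_inner b y))
  simp [sq]

/-- Solutions whose initial states have finitely many Fourier modes. -/
theorem exists_galerkin_solution (b : HilbertBasis ι ℝ H) {ℓ : ι → ℝ} {M : H →L[ℝ] H} {β l : ℝ}
    (hl : 0 < l) (hβ : -l < β) (hℓ : ∀ i, l ≤ ℓ i) (hM : IsDiagonal b (fun i => (ℓ i)⁻¹) M)
    (J : Finset ι) (x₀ v₀ w₀ : H) : ∃ x v w : ℝ → H, x 0 = partialSum b J x₀ ∧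
      v 0 = partialSum b J v₀ ∧ w 0 = partialSum b J w₀ ∧ IsStrongSolution M β x v w ∧
      ∀ t, 0 ≤ t → triSq (x t) (v t) (w t) ≤
        sqBound β l (triSq x₀ v₀ w₀) * Real.exp (-sqRate β l * t) := by
  classical
  set V : Submodule ℝ H := Submodule.span ℝ (J.image b : Set H) with hV
  let bV : OrthonormalBasis J ℝ V := OrthonormalBasis.span b.orthonormal J
  have hbV : ∀ j, ((bV j : V) : H) = b j := fun j => OrthonormalBasis.span_apply _ _ _
  have : FiniteDimensional ℝ V := bV.toBasis.finiteDimensional_of_finite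
  obtain ⟨L, N, hLN, -, hN⟩ := exists_isPositivePair bV.toHilbertBasis hl
    (ℓ := fun j : J => ℓ j) (fun j => hℓ j)
  -- The span of finitely many eigenvectors is invariant under `M`, and the force is a multiple of
  -- its argument. Thus solutions in `V` solve the original system exactly, without projecting the
  -- nonlinearity.
  have hcomm : ∀ y : V, ((N y : V) : H) = M y := by
    have : V.subtype ∘ₗ (N : V →ₗ[ℝ] V) = (M : H →ₗ[ℝ] H) ∘ₗ V.subtype := by
      refine bV.toBasis.ext fun j => ?_
      have h1 := hN.apply_basis j
      rw [bV.coe_toHilbertBasis] at h1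
      simp [h1, hbV, hM.apply_basis]
    exact fun y => LinearMap.congr_fun this y
  have hmem : ∀ y, partialSum b J y ∈ V := fun y =>
    Submodule.sum_mem _ fun i hi => Submodule.smul_mem _ _
      (Submodule.subset_span (by simpa using ⟨i, hi, rfl⟩))
  obtain ⟨x, v, w, hx0, hv0, hw0, hx, hv, hw⟩ := exists_finiteDimensional_solution hLN hl hβ
    ⟨_, hmem x₀⟩ ⟨_, hmem v₀⟩ ⟨_, hmem w₀⟩
  have hc : ∀ {y y' : ℝ → V}, (∀ t, 0 ≤ t → HasDerivWithinAt y (y' t) (Ici 0) t) →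
      ContinuousOn (fun t => (y t : H)) (Ici 0) := fun hy =>
    continuous_subtype_val.comp_continuousOn fun t ht => (hy t ht).continuousWithinAt
  have hd : ∀ {y : ℝ → V} {y' : V} {t : ℝ}, HasDerivWithinAt y y' (Ici 0) t →
      HasDerivWithinAt (fun t => M (y t)) ((N y' : V) : H) (Ici 0) t := fun {y y' t} hy => by
    have := (V.subtypeL.comp N).hasFDerivAt.comp_hasDerivWithinAt t hy
    exact this.congr_of_eventuallyEq (Eventually.of_forall fun s => (hcomm (y s)).symm)
      (hcomm (y t)).symm
  refine ⟨fun t => x t, fun t => v t, fun t => w t, by simp [hx0], by simp [hv0], by simp [hw0],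
    ⟨hc hx, hc hv, hc hw, fun t ht => ?_, fun t ht => ?_, fun t ht => ?_⟩, fun t ht => ?_⟩
  · exact (hd (hx t ht)).congr_deriv (by rw [hLN.left_inv])
  · refine (hd (hv t ht)).congr_deriv ?_
    have : inner ℝ (N (x t)) (x t) = inner ℝ (M (x t)) (x t : H) := by
      rw [← hcomm]; rfl
    simp only [velField, force, map_sub, map_add, map_neg, hLN.left_inv, map_smul, this,
      Submodule.coe_sub, Submodule.coe_add, Submodule.coe_neg, Submodule.coe_smul, hcomm]
  · refine (hd (hw t ht)).congr_deriv ?_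
    simp only [map_sub, map_neg, hLN.left_inv, Submodule.coe_sub, Submodule.coe_neg]
  · have h1 := sq_norm_le_of_solution hLN hl hβ hx hv hw ht
    refine h1.trans (mul_le_mul_of_nonneg_right ?_ (Real.exp_pos _).le)
    refine (sqBound_strictMonoOn hl hβ).monotoneOn (mem_Ici.2 (by positivity))
      (triSq_nonneg _ _ _) ?_
    rw [hx0, hv0, hw0]
    exact add_le_add (add_le_add (norm_partialSum_le b J x₀) (norm_partialSum_le b J v₀))
      (norm_partialSum_le b J w₀)

theorem tendstoUniformlyOn_of_dist_le_mul {α E : Type*} [PseudoMetricSpace E] {l : Filter α}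
    {F G : α → ℝ → E} {f g : ℝ → E} {s : Set ℝ} {C : ℝ} (hC : 0 ≤ C)
    (h : ∀ a, ∀ t ∈ s, dist (g t) (G a t) ≤ C * dist (f t) (F a t))
    (hF : TendstoUniformlyOn F f l s) : TendstoUniformlyOn G g l s := by
  rw [Metric.tendstoUniformlyOn_iff] at hF ⊢
  intro ε hε
  filter_upwards [hF (ε / (C + 1)) (by positivity)] with a ha t ht
  refine (h a t ht).trans_lt ?_
  have h1 := ha t ht
  rw [lt_div_iff₀ (by positivity)] at h1
  nlinarith [dist_nonneg (x := f t) (y := F a t)]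

/-- Families that are uniformly Cauchy on compact time intervals have a limit. -/
theorem exists_tendstoUniformlyOn {α E : Type*} [Nonempty α] [SemilatticeSup α]
    [PseudoMetricSpace E] [CompleteSpace E] {F : α → ℝ → E} {δ : ℝ → α × α → ℝ}
    (h : ∀ T, ∀ n : α × α, ∀ t ∈ Icc 0 T, dist (F n.1 t) (F n.2 t) ≤ δ T n)
    (hδ : ∀ T, Tendsto (δ T) atTop (𝓝 0)) :
    ∃ f : ℝ → E, ∀ T, TendstoUniformlyOn F f atTop (Icc 0 T) := by
  have hlim : ∀ t, ∃ y, 0 ≤ t → Tendsto (fun a => F a t) atTop (𝓝 y) := fun t => by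
    by_cases ht : 0 ≤ t
    · exact (cauchySeq_tendsto_of_complete (cauchySeq_iff_tendsto_dist_atTop_0.2
        (squeeze_zero (fun _ => dist_nonneg) (fun n => h t n t ⟨ht, le_rfl⟩) (hδ t)))).imp
          fun y hy _ => hy
    · exact ⟨F (Classical.arbitrary α) t, fun h => absurd h ht⟩
  choose f hf using hlim
  refine ⟨f, fun T => UniformCauchySeqOn.tendstoUniformlyOn_of_tendsto ?_ fun t ht => hf t ht.1⟩
  intro u hu
  obtain ⟨ε, hε, hεu⟩ := Metric.mem_uniformity_dist.1 hu
  rw [prod_atTop_atTop_eq]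
  filter_upwards [(hδ T).eventually_lt_const hε] with n hn t ht
  exact hεu ((h T n t ht).trans_lt hn)

theorem continuousOn_Ici_of_tendstoUniformlyOn {α E : Type*} [PseudoMetricSpace E]
    {l : Filter α} [l.NeBot] {F : α → ℝ → E} {f : ℝ → E} (hF : ∀ a, ContinuousOn (F a) (Ici 0))
    (h : ∀ T, TendstoUniformlyOn F f l (Icc 0 T)) : ContinuousOn f (Ici 0) := by
  intro t ht
  have h1 := (h (t + 1)).continuousOn
    (Frequently.of_forall fun a => (hF a).mono Icc_subset_Ici_self)
  refine (h1 t ⟨ht, by linarith⟩).mono_of_mem_nhdsWithin ?_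
  rw [← Ici_inter_Iic]
  exact inter_mem_nhdsWithin _ (Iic_mem_nhds (by linarith))

theorem tendsto_partialSum_sub (b : HilbertBasis ι ℝ H) (y : H) :
    Tendsto (fun n : Finset ι × Finset ι => partialSum b n.1 y - partialSum b n.2 y)
      atTop (𝓝 0) := by
  have h := tendsto_partialSum b y
  rw [← prod_atTop_atTop_eq]
  simpa using (h.comp tendsto_fst).sub (h.comp tendsto_snd)

/-- Limits of strong solutions that converge uniformly on compact time intervals. -/
theorem IsStrongSolution.of_tendstoUniformlyOn [CompleteSpace H] {α : Type*} {m : Filter α}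
    [m.NeBot] {M : H →L[ℝ] H} {β l R : ℝ} (hl : 0 < l) (hM : ∀ x, ‖M x‖ ≤ l⁻¹ * ‖x‖)
    {X V W : α → ℝ → H} {x v w : ℝ → H} (hS : ∀ a, IsStrongSolution M β (X a) (V a) (W a))
    (hR : ∀ a t, 0 ≤ t → ‖X a t‖ ≤ R) (hX : ∀ T, TendstoUniformlyOn X x m (Icc 0 T))
    (hV : ∀ T, TendstoUniformlyOn V v m (Icc 0 T))
    (hW : ∀ T, TendstoUniformlyOn W w m (Icc 0 T)) : IsStrongSolution M β x v w := by
  have hcx := continuousOn_Ici_of_tendstoUniformlyOn (fun a => (hS a).contX) hX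
  have hcv := continuousOn_Ici_of_tendstoUniformlyOn (fun a => (hS a).contV) hV
  have hcw := continuousOn_Ici_of_tendstoUniformlyOn (fun a => (hS a).contW) hW
  have hxR : ∀ t, 0 ≤ t → ‖x t‖ ≤ R := fun t ht =>
    le_of_tendsto' ((hX t).tendsto_at ⟨ht, le_rfl⟩).norm fun a => hR a t ht
  have hfc : Continuous fun y => M (force β M y) := by
    unfold force
    exact M.continuous.comp
      ((continuous_const.add (M.continuous.inner continuous_id)).smul continuous_id)
  have hF0 := forceLip_nonneg (β := β) (R := R) hl
  have hMl : ∀ {Y : α → ℝ → H} {y : ℝ → H}, (∀ T, TendstoUniformlyOn Y y m (Icc 0 T)) →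
      ∀ t, 0 ≤ t → Tendsto (fun a => M (Y a t)) m (𝓝 (M (y t))) := fun hY t ht =>
    (M.continuous.tendsto _).comp ((hY t).tendsto_at ⟨ht, le_rfl⟩)
  have hforce : ∀ T, TendstoUniformlyOn (fun a t => M (force β M (X a t)))
      (fun t => M (force β M (x t))) m (Icc 0 T) := fun T =>
    tendstoUniformlyOn_of_dist_le_mul (C := l⁻¹ * forceLip β l R) (by positivity)
      (fun a t ht => by
        rw [dist_eq_norm, dist_eq_norm, ← map_sub, mul_assoc]
        exact (hM _).trans (mul_le_mul_of_nonneg_left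
          (norm_force_sub_le hl hM (hxR t ht.1) (hR a t ht.1)) (by positivity))) (hX T)
  refine ⟨hcx, hcv, hcw, fun t ht => ?_, fun t ht => ?_, fun t ht => ?_⟩
  · exact hasDerivWithinAt_of_tendstoUniformlyOn (fun a => (hS a).contV) hcv
      (fun a => (hS a).derivX) (hMl hX) (fun T _ => hV T) ht
  · exact hasDerivWithinAt_of_tendstoUniformlyOn
      (r := fun a t => -X a t + W a t - M (force β M (X a t)))
      (r' := fun t => -x t + w t - M (force β M (x t)))
      (fun a => ((hS a).contX.neg.add (hS a).contW).sub (hfc.comp_continuousOn (hS a).contX))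
      ((hcx.neg.add hcw).sub (hfc.comp_continuousOn hcx))
      (fun a => (hS a).derivV) (hMl hV)
      (fun T _ => ((hX T).neg.add (hW T)).sub (hforce T)) ht
  · exact hasDerivWithinAt_of_tendstoUniformlyOn
      (r := fun a t => -W a t - V a t) (r' := fun t => -w t - v t)
      (fun a => (hS a).contW.neg.sub (hS a).contV) (hcw.neg.sub hcv)
      (fun a => (hS a).derivW) (hMl hW) (fun T _ => (hW T).neg.sub (hV T)) ht

/-- Global solvability of the beam system with exponential decay. -/
theorem exists_strongSolution [CompleteSpace H] (b : HilbertBasis ι ℝ H) {ℓ : ι → ℝ}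
    {M : H →L[ℝ] H} {β l : ℝ} (hl : 0 < l) (hβ : -l < β) (hℓ : ∀ i, l ≤ ℓ i)
    (hM : IsDiagonal b (fun i => (ℓ i)⁻¹) M) (x₀ v₀ w₀ : H) : ∃ x v w : ℝ → H,
      x 0 = x₀ ∧ v 0 = v₀ ∧ w 0 = w₀ ∧ IsStrongSolution M β x v w ∧
      ∀ t, 0 ≤ t → triSq (x t) (v t) (w t) ≤
        sqBound β l (triSq x₀ v₀ w₀) * Real.exp (-sqRate β l * t) := by
  classical
  have hpos : ∀ i, 0 < ℓ i := fun i => hl.trans_le (hℓ i)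
  have hMn : ∀ x, ‖M x‖ ≤ l⁻¹ * ‖x‖ := hM.norm_le (by positivity) fun i => by
    rw [abs_of_pos (inv_pos.2 (hpos i))]; exact inv_anti₀ hl (hℓ i)
  choose X V W hX0 hV0 hW0 hS hdec using
    fun J => exists_galerkin_solution b hl hβ hℓ hM J x₀ v₀ w₀
  -- The decay estimate bounds all finite-mode solutions by one `R`, so the Lipschitz constant of
  -- the force and the growth rate `K` do not depend on `J`.
  set R : ℝ := √(sqBound β l (triSq x₀ v₀ w₀)) with hR
  have hXR : ∀ J t, 0 ≤ t → ‖X J t‖ ≤ R := fun J t ht => by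
    refine (norm_le_sqrt_triSq _ (V J t) (W J t)).1.trans
      (Real.sqrt_le_sqrt ((hdec J t ht).trans ?_))
    refine mul_le_of_le_one_right (sqBound_nonneg hl hβ (triSq_nonneg _ _ _)) ?_
    rw [Real.exp_le_one_iff, neg_mul, neg_nonpos]
    exact mul_nonneg (sqRate_pos hl hβ).le ht
  set K := splitRate β l R with hK
  have hK0 : 0 ≤ K := by simp only [hK, splitRate]; positivity
  set δ : ℝ → Finset ι × Finset ι → ℝ := fun T n =>
    √(triSq (partialSum b n.1 x₀ - partialSum b n.2 x₀) (partialSum b n.1 v₀ - partialSum b n.2 v₀)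
      (partialSum b n.1 w₀ - partialSum b n.2 w₀) * Real.exp (K * T)) with hδ
  have hδ0 : ∀ T, Tendsto (δ T) atTop (𝓝 0) := fun T => by
    have h1 := ((tendsto_triSq (tendsto_partialSum_sub b x₀) (tendsto_partialSum_sub b v₀)
      (tendsto_partialSum_sub b w₀)).mul_const (Real.exp (K * T))).sqrt
    rwa [show triSq (0 : H) 0 0 = 0 by simp [triSq], zero_mul, Real.sqrt_zero] at h1
  have hcomp : ∀ T n, ∀ t ∈ Icc 0 T, √(triSq (X n.1 t - X n.2 t) (V n.1 t - V n.2 t)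
      (W n.1 t - W n.2 t)) ≤ δ T n := fun T n t ht => by
    have := ((hS n.1).isModeSolution (fun i => (hpos i).ne') hM).triSq_sub_le (R := R) hl
      (fun i => (hpos i).le) hMn ((hS n.2).isModeSolution (fun i => (hpos i).ne') hM)
      (fun s hs => hXR n.1 s hs.1) (fun s hs => hXR n.2 s hs.1) ht
    simp only [hX0, hV0, hW0] at this
    refine Real.sqrt_le_sqrt (this.trans (mul_le_mul_of_nonneg_left
      (Real.exp_le_exp.2 ?_) (triSq_nonneg _ _ _)))
    exact mul_le_mul_of_nonneg_left ht.2 hK0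
  obtain ⟨x, hx⟩ := exists_tendstoUniformlyOn (F := X) (δ := δ) (fun T n t ht => by
    rw [dist_eq_norm]
    exact (norm_le_sqrt_triSq _ _ _).1.trans (hcomp T n t ht)) hδ0
  obtain ⟨v, hv⟩ := exists_tendstoUniformlyOn (F := V) (δ := δ) (fun T n t ht => by
    rw [dist_eq_norm]
    exact (norm_le_sqrt_triSq _ _ _).2.1.trans (hcomp T n t ht)) hδ0
  obtain ⟨w, hw⟩ := exists_tendstoUniformlyOn (F := W) (δ := δ) (fun T n t ht => by
    rw [dist_eq_norm]
    exact (norm_le_sqrt_triSq _ _ _).2.2.trans (hcomp T n t ht)) hδ0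
  have hat : ∀ {Y : Finset ι → ℝ → H} {y : ℝ → H},
      (∀ T, TendstoUniformlyOn Y y atTop (Icc 0 T)) → ∀ t, 0 ≤ t →
      Tendsto (fun J => Y J t) atTop (𝓝 (y t)) := fun hY t ht => (hY t).tendsto_at ⟨ht, le_rfl⟩
  refine ⟨x, v, w, ?_, ?_, ?_, .of_tendstoUniformlyOn hl hMn hS hXR hx hv hw, fun t ht => ?_⟩
  · exact tendsto_nhds_unique (hat hx 0 le_rfl) (by simpa only [hX0] using tendsto_partialSum b x₀)
  · exact tendsto_nhds_unique (hat hv 0 le_rfl) (by simpa only [hV0] using tendsto_partialSum b v₀)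
  · exact tendsto_nhds_unique (hat hw 0 le_rfl) (by simpa only [hW0] using tendsto_partialSum b w₀)
  · exact le_of_tendsto' (tendsto_triSq (hat hx t ht) (hat hv t ht) (hat hw t ht))
      fun J => hdec J t ht

end Existence

-- The compact inverse of A and an eigenbasis

section Spectral

variable {H : Type u} [NormedAddCommGroup H] [InnerProductSpace ℝ H] [CompleteSpace H]
  {A : H →ₗ.[ℝ] H}

theorem mul_norm_le_norm_apply {H : Type*} [NormedAddCommGroup H] [InnerProductSpace ℝ H]
    {A : H →ₗ.[ℝ] H} {c : ℝ} (hc : ∀ x : A.domain, c * ‖(x : H)‖ ^ 2 ≤ inner ℝ (A x) (x : H))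
    (x : A.domain) : c * ‖(x : H)‖ ≤ ‖A x‖ := by
  rcases eq_or_ne ‖(x : H)‖ 0 with h | h
  · rw [h, mul_zero]; exact norm_nonneg _
  · have hp : 0 < ‖(x : H)‖ := lt_of_le_of_ne (norm_nonneg _) h.symm
    have := (hc x).trans (real_inner_le_norm _ _)
    rw [pow_two, ← mul_assoc] at this
    exact le_of_mul_le_mul_right this hp

namespace IsBeamOperator

theorem isFormalAdjoint (hA : IsBeamOperator A) : A.IsFormalAdjoint A := by
  have := LinearPMap.adjoint_isFormalAdjoint hA.selfAdjoint.dense_domain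
  rwa [LinearPMap.isSelfAdjoint_def.1 hA.selfAdjoint] at this

/-- The range is closed because the graph is closed and `A` is bounded below. A vector orthogonal to
the range lies in the domain of the adjoint, which is `A`, and is annihilated by it; strict
positivity makes it zero. -/
theorem range_eq_top (hA : IsBeamOperator A) : LinearMap.range A.toFun = ⊤ := by
  obtain ⟨c, hc0, hc⟩ := hA.strictlyPositive
  have hcl : IsClosed (LinearMap.range A.toFun : Set H) := by
    have hG : IsClosed (A.graph : Set (H × H)) := hA.selfAdjoint.isClosed
    have : CompleteSpace A.graph := hG.completeSpace_coe
    let f : A.graph →L[ℝ] H := (ContinuousLinearMap.snd ℝ H H).comp A.graph.subtypeL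
    have hf : AntilipschitzWith (max c⁻¹ 1).toNNReal f := by
      refine AddMonoidHomClass.antilipschitz_of_bound f fun p => ?_
      obtain ⟨x, hx1, hx2⟩ := (LinearPMap.mem_graph_iff A).1 p.2
      rw [Real.coe_toNNReal _ (by positivity)]
      have hfp : f p = (p : H × H).2 := rfl
      rw [hfp]
      refine max_le ?_ ?_
      · change ‖(p : H × H).1‖ ≤ _
        rw [← hx1, ← hx2]
        refine le_trans ?_ (mul_le_mul_of_nonneg_right (le_max_left c⁻¹ 1) (norm_nonneg _))
        rw [le_inv_mul_iff₀ hc0]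
        exact mul_norm_le_norm_apply hc x
      · exact le_mul_of_one_le_left (norm_nonneg _) (le_max_right _ _)
    have h1 := hf.isClosed_range f.uniformContinuous
    convert h1 using 1
    ext z
    constructor
    · rintro ⟨x, rfl⟩
      exact ⟨⟨(x, A x), A.mem_graph x⟩, rfl⟩
    · rintro ⟨p, rfl⟩
      obtain ⟨x, -, hx2⟩ := (LinearPMap.mem_graph_iff A).1 p.2
      exact ⟨x, hx2⟩
  have : CompleteSpace (LinearMap.range A.toFun) := hcl.completeSpace_coe
  rw [← Submodule.orthogonal_eq_bot_iff, Submodule.eq_bot_iff]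
  intro y hy
  have hort : ∀ x : A.domain, inner ℝ (0 : H) (x : H) = inner ℝ y (A x) := fun x => by
    rw [inner_zero_left, real_inner_comm]
    exact (Submodule.mem_orthogonal _ _ |>.1 hy _ ⟨x, rfl⟩).symm
  have hdom := LinearPMap.mem_adjoint_domain_of_exists (T := A) y ⟨0, hort⟩
  have h0 := LinearPMap.adjoint_apply_eq hA.selfAdjoint.dense_domain ⟨y, hdom⟩ hort
  have hgr : (y, (0 : H)) ∈ A.graph := by
    have h1 : (y, (0 : H)) ∈ A.adjoint.graph :=
      (LinearPMap.mem_graph_iff _).2 ⟨⟨y, hdom⟩, rfl, h0⟩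
    rwa [LinearPMap.isSelfAdjoint_def.1 hA.selfAdjoint] at h1
  obtain ⟨x, hx1, hx2⟩ := (LinearPMap.mem_graph_iff A).1 hgr
  have h2 := hc x
  rw [hx2, inner_zero_left, hx1] at h2
  have h3 : ‖y‖ ^ 2 ≤ 0 := nonpos_of_mul_nonpos_right h2 hc0
  exact norm_eq_zero.1 (pow_eq_zero_iff two_ne_zero |>.1 (le_antisymm h3 (sq_nonneg _)))

/-- The inverse of `A` is a compact symmetric injective operator. -/
theorem exists_inverse (hA : IsBeamOperator A) : ∃ T : H →L[ℝ] H, IsCompactOperator T ∧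
    (T : H →ₗ[ℝ] H).IsSymmetric ∧ ∀ y, ∃ x : A.domain, (x : H) = T y ∧ A x = y := by
  obtain ⟨c, hc0, hc⟩ := hA.strictlyPositive
  have hinj : Function.Injective A.toFun := by
    rw [← LinearMap.ker_eq_bot, LinearMap.ker_eq_bot']
    intro x hx
    have := mul_norm_le_norm_apply hc x
    rw [show A x = 0 from hx, norm_zero] at this
    exact Subtype.ext (norm_eq_zero.1
      (le_antisymm (nonpos_of_mul_nonpos_right this hc0) (norm_nonneg _)))
  let e : A.domain ≃ₗ[ℝ] H :=
    LinearEquiv.ofBijective A.toFun ⟨hinj, LinearMap.range_eq_top.1 hA.range_eq_top⟩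
  have he : ∀ y, A (e.symm y) = y := fun y => e.apply_symm_apply y
  have hbd : ∀ y, ‖(e.symm y : H)‖ ≤ c⁻¹ * ‖y‖ := fun y => by
    rw [le_inv_mul_iff₀ hc0]
    have := mul_norm_le_norm_apply hc (e.symm y)
    rwa [he] at this
  let T : H →L[ℝ] H := (A.domain.subtype ∘ₗ (e.symm : H →ₗ[ℝ] A.domain)).mkContinuous c⁻¹ hbd
  have hT : ∀ y, T y = e.symm y := fun y => rfl
  refine ⟨T, ?_, fun y z => ?_, fun y => ⟨e.symm y, rfl, he y⟩⟩
  -- On a ball of this radius ‖T y‖² + ‖y‖² ≤ (1 + c⁻¹)²‖y‖² ≤ 1, so its image lies in the unit ball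
  -- of the graph norm.
  · have hr : (0 : ℝ) < (1 + c⁻¹)⁻¹ := by positivity
    refine (isCompactOperator_iff_isCompact_closure_image_closedBall (T : H →ₗ[ℝ] H) hr).2 ?_
    refine hA.compactEmbedding.of_isClosed_subset isClosed_closure (closure_mono ?_)
    rintro _ ⟨y, hy, rfl⟩
    rw [mem_closedBall_zero_iff] at hy
    refine ⟨e.symm y, rfl, ?_⟩
    rw [he]
    have h1 := hbd y
    have h2 := mul_le_mul_of_nonneg_left hy (by positivity : 0 ≤ 1 + c⁻¹)
    rw [mul_inv_cancel₀ (by positivity)] at h2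
    have h3 : ‖(e.symm y : H)‖ ^ 2 ≤ (c⁻¹ * ‖y‖) ^ 2 :=
      pow_le_pow_left₀ (norm_nonneg _) h1 2
    have h4 : ((1 + c⁻¹) * ‖y‖) ^ 2 ≤ 1 := pow_le_one₀ (by positivity) h2
    have h5 : 0 ≤ c⁻¹ * ‖y‖ ^ 2 := by positivity
    nlinarith
  · have := hA.isFormalAdjoint (e.symm y) (e.symm z)
    rw [he, he] at this
    exact this.symm

/-- There is a Hilbert basis of eigenvectors of `A`. -/
theorem exists_eigenbasis (hA : IsBeamOperator A) : ∃ (ι : Type u) (b : HilbertBasis ι ℝ H)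
    (lam : ι → ℝ), ∀ i, ∃ x : A.domain, (x : H) = b i ∧ A x = lam i • b i := by
  obtain ⟨T, hTc, hTs, hTA⟩ := hA.exists_inverse
  set E : ℝ → Submodule ℝ H := fun μ => Module.End.eigenspace (T : Module.End ℝ H) μ with hE
  have hEc : ∀ μ, CompleteSpace (E μ) := fun μ => by
    have : E μ = LinearMap.ker ((T - μ • ContinuousLinearMap.id ℝ H : H →L[ℝ] H) : H →ₗ[ℝ] H) := by
      ext y
      simp [hE, sub_eq_zero]
    rw [this]
    exact (ContinuousLinearMap.isClosed_ker _).completeSpace_coe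
  choose W b _ using fun μ => exists_hilbertBasis ℝ (E μ)
  have hon : Orthonormal ℝ fun a : Σ μ, W μ => ((b a.1 a.2 : E a.1) : H) :=
    hTs.orthogonalFamily_eigenspaces.orthonormal_sigma_orthonormal fun μ => (b μ).orthonormal
  have hbot : (Submodule.span ℝ (range fun a : Σ μ, W μ => ((b a.1 a.2 : E a.1) : H)))ᗮ = ⊥ := by
    rw [Submodule.eq_bot_iff]
    intro y hy
    have hyE : y ∈ (⨆ μ, E μ)ᗮ := by
      rw [← Submodule.iInf_orthogonal, Submodule.mem_iInf]
      intro μ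
      rw [← Submodule.orthogonalProjectionOnto_eq_zero_iff]
      refine hilbertBasis_ext (b μ) fun i => ?_
      rw [inner_zero_right, Submodule.inner_orthogonalProjectionOnto_eq_of_mem_left]
      exact Submodule.mem_orthogonal _ _ |>.1 hy _ (Submodule.subset_span ⟨⟨μ, i⟩, rfl⟩)
    rw [ContinuousLinearMap.orthogonalComplement_iSup_eigenspaces_eq_bot hTc hTs] at hyE
    simpa using hyE
  let B := HilbertBasis.mkOfOrthogonalEqBot hon hbot
  have hB : ∀ a : Σ μ, W μ, B a = ((b a.1 a.2 : E a.1) : H) := fun a => by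
    simp only [B, HilbertBasis.coe_mkOfOrthogonalEqBot]
  refine ⟨Σ μ, W μ, B, fun a => a.1⁻¹, fun a => ?_⟩
  have hmem : T (B a) = a.1 • B a := by
    rw [hB]; exact Module.End.mem_eigenspace_iff.1 (b a.1 a.2).2
  obtain ⟨x, hx1, hx2⟩ := hTA (B a)
  -- `T` is injective, since `A` undoes it; so the eigenvalue 0 contributes no basis vector and the
  -- others can be inverted.
  have hne : a.1 ≠ 0 := by
    intro h
    rw [hmem, h, zero_smul] at hx1
    have h0 : x = 0 := Subtype.ext hx1
    rw [h0, LinearPMap.map_zero] at hx2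
    exact B.orthonormal.ne_zero a hx2.symm
  refine ⟨a.1⁻¹ • x, ?_, ?_⟩
  · rw [Submodule.coe_smul, hx1, hmem, smul_smul, inv_mul_cancel₀ hne, one_smul]
  · rw [LinearPMap.map_smul, hx2]

end IsBeamOperator

end Spectral

-- Eigenprojections and powers of A in coordinates

section Powers

variable {H : Type u} [NormedAddCommGroup H] [InnerProductSpace ℝ H] [CompleteSpace H]
  {A : H →ₗ.[ℝ] H} {ι : Type*} {b : HilbertBasis ι ℝ H} {lam : ι → ℝ}

theorem mem_eigenspace_iff {H : Type u} [NormedAddCommGroup H] [InnerProductSpace ℝ H]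
    {A : H →ₗ.[ℝ] H} {μ : ℝ} {y : H} :
    y ∈ eigenspace A μ ↔ ∃ x : A.domain, (x : H) = y ∧ A x = μ • y := by
  constructor
  · rintro ⟨x, hx, rfl⟩
    exact ⟨x, rfl, sub_eq_zero.1 (by simpa using hx)⟩
  · rintro ⟨x, rfl, hx⟩
    exact ⟨x, by simpa [sub_eq_zero] using hx, rfl⟩

theorem le_of_eigenspace_ne_bot {H : Type u} [NormedAddCommGroup H] [InnerProductSpace ℝ H]
    {A : H →ₗ.[ℝ] H} {c μ : ℝ} (hc : ∀ x : A.domain, c * ‖(x : H)‖ ^ 2 ≤ inner ℝ (A x) (x : H))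
    (h : eigenspace A μ ≠ ⊥) : c ≤ μ := by
  obtain ⟨y, hy, hy0⟩ := Submodule.exists_mem_ne_zero_of_ne_bot h
  obtain ⟨x, rfl, hx⟩ := mem_eigenspace_iff.1 hy
  have h1 := hc x
  rw [hx, real_inner_smul_left, real_inner_self_eq_norm_sq] at h1
  exact le_of_mul_le_mul_right h1 (by positivity)

theorem eigenspace_ne_bot {H : Type u} [NormedAddCommGroup H] [InnerProductSpace ℝ H]
    {A : H →ₗ.[ℝ] H} {ι : Type*} {b : HilbertBasis ι ℝ H} {lam : ι → ℝ}
    (hb : ∀ i, b i ∈ eigenspace A (lam i)) (i : ι) : eigenspace A (lam i) ≠ ⊥ := fun h =>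
  b.orthonormal.ne_zero i ((Submodule.eq_bot_iff _).1 h _ (hb i))

/-- The first eigenvalue is positive and a lower bound of all eigenvalues of a basis. -/
theorem IsBeamOperator.firstEigenvalue_pos [Nontrivial H] (hA : IsBeamOperator A)
    (hb : ∀ i, b i ∈ eigenspace A (lam i)) :
    0 < firstEigenvalue A ∧ ∀ i, firstEigenvalue A ≤ lam i := by
  obtain ⟨c, hc0, hc⟩ := hA.strictlyPositive
  have hbdd : BddBelow {μ : ℝ | eigenspace A μ ≠ ⊥} :=
    ⟨c, fun μ hμ => le_of_eigenspace_ne_bot hc hμ⟩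
  have hne : Nonempty ι := by
    by_contra hι
    rw [not_nonempty_iff] at hι
    obtain ⟨x, y, hxy⟩ := exists_pair_ne H
    exact hxy (hilbertBasis_ext b fun i => isEmptyElim i)
  refine ⟨hc0.trans_le (le_csInf ?_ fun μ hμ => le_of_eigenspace_ne_bot hc hμ),
    fun i => csInf_le hbdd (eigenspace_ne_bot hb i)⟩
  exact ⟨lam hne.some, eigenspace_ne_bot hb hne.some⟩

-- Eigenvectors of a symmetric operator with different eigenvalues are orthogonal, so the projection
-- keeps or kills each basis vector.
open Classical in
theorem IsBeamOperator.eigenProj_basis (hA : IsBeamOperator A)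
    (hb : ∀ i, b i ∈ eigenspace A (lam i)) (μ : ℝ) (i : ι) :
    eigenProj A μ (b i) = if lam i = μ then b i else 0 := by
  unfold eigenProj
  split_ifs with h
  · exact Submodule.starProjection_eq_self_iff.2
      (Submodule.le_topologicalClosure _ (h ▸ hb i))
  · rw [Submodule.starProjection_apply_eq_zero_iff, Submodule.orthogonal_closure]
    rw [Submodule.mem_orthogonal]
    intro z hz
    obtain ⟨x, hx, hAx⟩ := mem_eigenspace_iff.1 (hb i)
    obtain ⟨y, rfl, hAy⟩ := mem_eigenspace_iff.1 hz
    have h1 := hA.isFormalAdjoint y x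
    rw [hAy, hAx, hx, real_inner_smul_left, inner_smul_right] at h1
    have h2 : (lam i - μ) * inner ℝ (y : H) (b i) = 0 := by linarith
    exact (mul_eq_zero.1 h2).resolve_left (sub_ne_zero.2 h)

open Classical in
theorem IsBeamOperator.inner_eigenProj (hA : IsBeamOperator A)
    (hb : ∀ i, b i ∈ eigenspace A (lam i)) (μ : ℝ) (i : ι) (y : H) :
    inner ℝ (b i) (eigenProj A μ y) = if lam i = μ then inner ℝ (b i) y else 0 := by
  have h := hA.eigenProj_basis hb μ i
  unfold eigenProj at h ⊢
  rw [← Submodule.inner_starProjection_left_eq_right, h]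
  split_ifs <;> simp

/-- Every vector is the sum of its eigenprojections. -/
theorem IsBeamOperator.hasSum_eigenProj (hA : IsBeamOperator A)
    (hb : ∀ i, b i ∈ eigenspace A (lam i)) (y : H) : HasSum (fun μ => eigenProj A μ y) y := by
  classical
  have hco : ∀ (S : Finset ℝ) (z : H) i, inner ℝ (b i) (∑ μ ∈ S, eigenProj A μ z) =
      if lam i ∈ S then inner ℝ (b i) z else 0 := fun S z i => by
    rw [inner_sum, Finset.sum_congr rfl fun μ _ => hA.inner_eigenProj hb μ i z,
      Finset.sum_ite_eq]
  have hcontr : ∀ (S : Finset ℝ) (z : H), ‖z - ∑ μ ∈ S, eigenProj A μ z‖ ≤ ‖z‖ := fun S z => by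
    refine abs_le_of_sq_le_sq' ?_ (norm_nonneg _) |>.2
    refine hasSum_le (fun i => ?_) (hasSum_sq_inner b _) (hasSum_sq_inner b z)
    rw [inner_sub_right, hco]
    split_ifs
    · rw [sub_self, zero_pow two_ne_zero]; exact sq_nonneg _
    · rw [sub_zero]
  have hfix : ∀ (S : Finset ℝ) (J : Finset ι), J.image lam ⊆ S →
      ∑ μ ∈ S, eigenProj A μ (partialSum b J y) = partialSum b J y := fun S J hJS => by
    refine hilbertBasis_ext b fun i => ?_
    rw [hco]
    split_ifs with hi
    · rfl
    · have hiJ : i ∉ J := fun h => hi (hJS (Finset.mem_image_of_mem _ h))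
      rw [partialSum, inner_sum, Finset.sum_eq_zero]
      intro j hj
      rw [inner_smul_right, orthonormal_iff_ite.1 b.orthonormal, if_neg (by rintro rfl; exact hiJ hj),
        mul_zero]
  -- Density argument: the remainder after a finite sum of projections is a contraction (`hcontr`),
  -- and it vanishes on a partial Fourier sum once `S` contains the eigenvalues involved (`hfix`).
  have : Tendsto (fun S : Finset ℝ => ∑ μ ∈ S, eigenProj A μ y) atTop (𝓝 y) := by
    rw [Metric.tendsto_nhds]
    intro ε hε
    obtain ⟨J, hJ⟩ := (Metric.tendsto_nhds.1 (tendsto_partialSum b y) ε hε).exists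
    filter_upwards [eventually_ge_atTop (J.image lam)] with S hS
    have h1 := hcontr S (y - partialSum b J y)
    simp only [map_sub, Finset.sum_sub_distrib, hfix S J hS] at h1
    rw [sub_sub_sub_cancel_right] at h1
    rw [dist_comm, dist_eq_norm] at hJ ⊢
    exact h1.trans_lt hJ
  exact this

/-- Powers of `A` in coordinates. -/
theorem IsBeamOperator.opPow_eq (hA : IsBeamOperator A)
    (hb : ∀ i, b i ∈ eigenspace A (lam i)) {s : ℝ} {y z : H}
    (h : ∀ i, inner ℝ (b i) z = lam i ^ s * inner ℝ (b i) y) :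
    y ∈ powDomain A s ∧ opPow A s y = z := by
  classical
  have h1 : HasSum (fun μ => μ ^ s • eigenProj A μ y) z := by
    refine (hA.hasSum_eigenProj hb z).congr_fun fun μ => ?_
    refine hilbertBasis_ext b fun i => ?_
    rw [inner_smul_right, hA.inner_eigenProj hb, hA.inner_eigenProj hb]
    split_ifs with hi
    · rw [h, hi]
    · rw [mul_zero]
  exact ⟨h1.summable, h1.tsum_eq⟩

theorem IsBeamOperator.inner_opPow (hA : IsBeamOperator A)
    (hb : ∀ i, b i ∈ eigenspace A (lam i)) {s : ℝ} {y : H} (hy : y ∈ powDomain A s) (i : ι) :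
    inner ℝ (b i) (opPow A s y) = lam i ^ s * inner ℝ (b i) y := by
  classical
  have h1 : HasSum (fun μ : ℝ => μ ^ s • eigenProj A μ y) (opPow A s y) := Summable.hasSum hy
  have h2 := h1.mapL (innerSL ℝ (b i))
  have hterm : ∀ μ, innerSL ℝ (b i) (μ ^ s • eigenProj A μ y) =
      if lam i = μ then μ ^ s * inner ℝ (b i) y else 0 := fun μ => by
    rw [innerSL_apply_apply, inner_smul_right, hA.inner_eigenProj hb]
    split_ifs <;> simp
  simp only [hterm] at h2
  refine h2.unique ?_
  convert! hasSum_ite_eq (lam i) (lam i ^ s * inner ℝ (b i) y) using 2 with μ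
  by_cases h : lam i = μ
  · rw [if_pos h, if_pos h.symm, h]
  · rw [if_neg h, if_neg (Ne.symm h)]

end Powers

-- The constants as elementary formulas

namespace Formula

variable {n : ℕ}

/-- The formula `a / b`. -/
def div (a b : Formula n) : Formula n := mul a (inv b)

/-- The formula `a - b`. -/
def sub (a b : Formula n) : Formula n := add a (neg b)

/-- The formula of `coercivity`. -/
def coercivity (β l : Formula n) : Formula n := sub (const 1) (div (max (const 0) (neg β)) l)

/-- The formula of `growth`. -/
def growth (β l : Formula n) : Formula n := add (const 1) (div (max β (neg β)) l)

/-- The formula of `multConst`. -/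
def multConst (β l : Formula n) : Formula n :=
  add (add (const 4) (div (const 1) (coercivity β l)))
    (div (mul (const 4) (mul β β)) (mul (coercivity β l) (mul l l)))

/-- The formula of `lyapWeight`. -/
def lyapWeight (β l : Formula n) : Formula n :=
  div l (mul (const 2) (add (multConst β l) (div (const 3) (coercivity β l))))

/-- The formula of `factorRate`. -/
def factorRate (β l : Formula n) : Formula n :=
  mul (const 2) (mul (lyapWeight β l)
    (div (const 4) (mul (coercivity β l) (mul (mul l l) l))))

/-- The formula of `sqRate`. -/
def sqRate (β l : Formula n) : Formula n :=
  div (mul (const 2) (div (mul (lyapWeight β l) (coercivity β l)) (growth β l))) (const 3)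

/-- The formula of `energyBound`. -/
def energyBound (β l ρ : Formula n) : Formula n :=
  add (div (mul (growth β l) ρ) (const 2)) (div (mul ρ ρ) (mul (const 4) (mul l l)))

/-- The formula of `sqBound`. -/
def sqBound (β l ρ : Formula n) : Formula n :=
  mul (div (const 6) (coercivity β l)) (mul (energyBound β l ρ)
    (exp (mul (factorRate β l) (energyBound β l ρ))))

variable (x : Fin n → ℝ) (β l ρ : Formula n)

theorem eval_div : (div β l).eval x = β.eval x / l.eval x := by
  simp [div, eval, div_eq_mul_inv]

theorem eval_sub : (sub β l).eval x = β.eval x - l.eval x := by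
  simp [sub, eval, sub_eq_add_neg]

theorem eval_coercivity :
    (coercivity β l).eval x = ThermoBeam.coercivity (β.eval x) (l.eval x) := by
  simp [coercivity, ThermoBeam.coercivity, eval_sub, eval_div, eval]

theorem eval_growth : (growth β l).eval x = ThermoBeam.growth (β.eval x) (l.eval x) := by
  simp [growth, ThermoBeam.growth, eval_div, eval]

theorem eval_multConst :
    (multConst β l).eval x = ThermoBeam.multConst (β.eval x) (l.eval x) := by
  simp [multConst, ThermoBeam.multConst, eval_div, eval, eval_coercivity, sq]

theorem eval_lyapWeight :
    (lyapWeight β l).eval x = ThermoBeam.lyapWeight (β.eval x) (l.eval x) := by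
  simp [lyapWeight, ThermoBeam.lyapWeight, eval_div, eval, eval_coercivity, eval_multConst]

theorem eval_factorRate :
    (factorRate β l).eval x = ThermoBeam.factorRate (β.eval x) (l.eval x) := by
  simp [factorRate, ThermoBeam.factorRate, eval_div, eval, eval_coercivity, eval_lyapWeight,
    pow_succ]

theorem eval_sqRate : (sqRate β l).eval x = ThermoBeam.sqRate (β.eval x) (l.eval x) := by
  simp [sqRate, ThermoBeam.sqRate, eval_div, eval, eval_coercivity, eval_lyapWeight, eval_growth]

theorem eval_energyBound : (energyBound β l ρ).eval x =
    ThermoBeam.energyBound (β.eval x) (l.eval x) (ρ.eval x) := by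
  simp [energyBound, ThermoBeam.energyBound, eval_div, eval, eval_growth, sq]

theorem eval_sqBound : (sqBound β l ρ).eval x =
    ThermoBeam.sqBound (β.eval x) (l.eval x) (ρ.eval x) := by
  simp [sqBound, ThermoBeam.sqBound, eval_div, eval, eval_coercivity, eval_energyBound,
    eval_factorRate]

end Formula

-- Norm and topology of the phase space

section PhaseSpaceNorm

variable {H : Type u} [NormedAddCommGroup H] [InnerProductSpace ℝ H] [CompleteSpace H]
  {A : H →ₗ.[ℝ] H}

theorem norm_spaceH2 (y : SpaceH2 A) : ‖y‖ = ‖sqrtMap A y‖ := rfl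

theorem isometry_sqrtMap : Isometry (sqrtMap A) :=
  AddMonoidHomClass.isometry_of_norm _ fun y => (norm_spaceH2 y).symm

theorem norm_sq_phaseSpace (z : PhaseSpace A) :
    ‖z‖ ^ 2 = triSq (sqrtMap A z.disp) z.vel z.temp := by
  rw [WithLp.prod_norm_sq_eq_of_L2, WithLp.prod_norm_sq_eq_of_L2, ← add_assoc, norm_spaceH2]
  rfl

theorem continuous_disp : Continuous (PhaseSpace.disp (A := A)) :=
  continuous_fst.comp (WithLp.prod_continuous_ofLp 2 _ _)

theorem continuous_vel : Continuous (PhaseSpace.vel (A := A)) :=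
  continuous_fst.comp ((WithLp.prod_continuous_ofLp 2 _ _).comp
    (continuous_snd.comp (WithLp.prod_continuous_ofLp 2 _ _)))

theorem continuous_temp : Continuous (PhaseSpace.temp (A := A)) :=
  continuous_snd.comp ((WithLp.prod_continuous_ofLp 2 _ _).comp
    (continuous_snd.comp (WithLp.prod_continuous_ofLp 2 _ _)))

/-- The topology of H² is induced by A^(1/2), so continuity of the displacement is tested after
applying `sqrtMap`. -/
theorem continuousOn_mk {y : ℝ → SpaceH2 A} {v θ : ℝ → H} {s : Set ℝ}
    (hy : ContinuousOn (fun t => sqrtMap A (y t)) s) (hv : ContinuousOn v s)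
    (hθ : ContinuousOn θ s) : ContinuousOn (fun t => PhaseSpace.mk (y t) (v t) (θ t)) s := by
  have hy' : ContinuousOn y s := (isometry_sqrtMap (A := A)).isUniformInducing.isInducing.continuousOn_iff.2 hy
  exact (WithLp.prod_continuous_toLp 2 _ _).comp_continuousOn
    (hy'.prodMk ((WithLp.prod_continuous_toLp 2 _ _).comp_continuousOn (hv.prodMk hθ)))

end PhaseSpaceNorm

-- Weak solutions in the coordinates (x, v, w)

section Coordinates

variable {H : Type u} [NormedAddCommGroup H] [InnerProductSpace ℝ H] [CompleteSpace H]

/-- `b` is a basis of eigenvectors of `A` and `M` is `A ^ (-1 / 2)`; the number `l` is a positive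
lower bound of the square roots `√(lam i)` of the eigenvalues. -/
structure IsEigenSystem {ι : Type*} (A : H →ₗ.[ℝ] H) (l : ℝ) (b : HilbertBasis ι ℝ H)
    (lam : ι → ℝ) (M : H →L[ℝ] H) : Prop where
  isBeamOperator : IsBeamOperator A
  mem : ∀ i, b i ∈ eigenspace A (lam i)
  pos : 0 < l
  le : ∀ i, l ≤ √(lam i)
  diag : IsDiagonal b (fun i => (√(lam i))⁻¹) M

theorem IsBeamOperator.exists_isEigenSystem [Nontrivial H] {A : H →ₗ.[ℝ] H}
    (hA : IsBeamOperator A) : ∃ (ι : Type u) (b : HilbertBasis ι ℝ H) (lam : ι → ℝ)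
      (M : H →L[ℝ] H), IsEigenSystem A √(firstEigenvalue A) b lam M := by
  obtain ⟨ι, b, lam, hb⟩ := hA.exists_eigenbasis
  have hb' : ∀ i, b i ∈ eigenspace A (lam i) := fun i => mem_eigenspace_iff.2 (hb i)
  obtain ⟨h0, h1⟩ := hA.firstEigenvalue_pos hb'
  have hl : 0 < √(firstEigenvalue A) := Real.sqrt_pos.2 h0
  have hle : ∀ i, √(firstEigenvalue A) ≤ √(lam i) := fun i => Real.sqrt_le_sqrt (h1 i)
  obtain ⟨M, hM⟩ := exists_isDiagonal b (a := fun i => (√(lam i))⁻¹)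
    (C := (√(firstEigenvalue A))⁻¹) (fun i => by
      rw [abs_of_nonneg (inv_nonneg.2 (Real.sqrt_nonneg _))]
      exact inv_anti₀ hl (hle i)) (by positivity)
  exact ⟨ι, b, lam, M, hA, hb', hl, hle, hM⟩

namespace IsEigenSystem

variable {ι : Type*} {A : H →ₗ.[ℝ] H} {l : ℝ} {b : HilbertBasis ι ℝ H} {lam : ι → ℝ}
  {M : H →L[ℝ] H}

theorem sqrt_pos (h : IsEigenSystem A l b lam M) (i : ι) : 0 < √(lam i) := h.pos.trans_le (h.le i)

theorem lam_pos (h : IsEigenSystem A l b lam M) (i : ι) : 0 < lam i := Real.sqrt_pos.1 (h.sqrt_pos i)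

theorem norm_le (h : IsEigenSystem A l b lam M) (x : H) : ‖M x‖ ≤ l⁻¹ * ‖x‖ :=
  h.diag.norm_le (inv_nonneg.2 h.pos.le) (fun i => by
    rw [abs_of_pos (inv_pos.2 (h.sqrt_pos i))]; exact inv_anti₀ h.pos (h.le i)) x

/-- Every element of `H` is `A ^ (1 / 2) u` for some `u ∈ H²`. -/
theorem exists_sqrtMap_eq (h : IsEigenSystem A l b lam M) (x : H) :
    ∃ y : SpaceH2 A, y.val = M x ∧ sqrtMap A y = x := by
  obtain ⟨h1, h2⟩ := h.isBeamOperator.opPow_eq h.mem (s := 1 / 2) (y := M x) (z := x) fun i => by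
    rw [h.diag, ← Real.sqrt_eq_rpow, mul_inv_cancel_left₀ (h.sqrt_pos i).ne']
  exact ⟨⟨M x, h1⟩, rfl, h2⟩

theorem val_eq (h : IsEigenSystem A l b lam M) (y : SpaceH2 A) : y.val = M (sqrtMap A y) := by
  refine hilbertBasis_ext b fun i => ?_
  have h1 : inner ℝ (b i) (sqrtMap A y) = lam i ^ (1 / 2 : ℝ) * inner ℝ (b i) y.val :=
    h.isBeamOperator.inner_opPow h.mem y.2 i
  rw [h.diag, h1, ← Real.sqrt_eq_rpow, inv_mul_cancel_left₀ (h.sqrt_pos i).ne']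

theorem sqrtMap_injective (h : IsEigenSystem A l b lam M) : Function.Injective (sqrtMap A) :=
  fun y y' hy => Subtype.ext (by
    change y.val = y'.val
    rw [h.val_eq, hy, ← h.val_eq])

/-- The diagonal operator `D` with entries `lam i ^ (-1/4)` is symmetric with square `M`, and
A^(1/4)u = D x. This turns the nonlocal coefficient ‖u‖₁² into a bounded quadratic form in x. -/
theorem norm_quarter_sq (h : IsEigenSystem A l b lam M) (y : SpaceH2 A) :
    ‖opPow A (1 / 4) y.val‖ ^ 2 = inner ℝ (M (sqrtMap A y)) (sqrtMap A y) := by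
  obtain ⟨D, hD⟩ := exists_isDiagonal b (a := fun i => (√(√(lam i)))⁻¹) (C := (√l)⁻¹)
    (fun i => by
      rw [abs_of_nonneg (inv_nonneg.2 (Real.sqrt_nonneg _))]
      exact inv_anti₀ (Real.sqrt_pos.2 h.pos) (Real.sqrt_le_sqrt (h.le i))) (by positivity)
  have hq : ∀ i, lam i ^ (1 / 4 : ℝ) = √(√(lam i)) := fun i => by
    rw [Real.sqrt_eq_rpow, Real.sqrt_eq_rpow, ← Real.rpow_mul (h.lam_pos i).le]
    norm_num
  have hne : ∀ i, √(√(lam i)) ≠ 0 := fun i => (Real.sqrt_pos.2 (h.sqrt_pos i)).ne'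
  have h1 := (h.isBeamOperator.opPow_eq h.mem (s := 1 / 4) (y := y.val) (z := D (sqrtMap A y))
    fun i => by
      have hs : (√(lam i))⁻¹ = (√(√(lam i)))⁻¹ * (√(√(lam i)))⁻¹ := by
        rw [← mul_inv, Real.mul_self_sqrt (Real.sqrt_nonneg _)]
      rw [h.val_eq y, hD, h.diag, hq]
      beta_reduce
      rw [hs, mul_assoc, mul_inv_cancel_left₀ (hne i)]).2
  have hDD : IsDiagonal b (fun i => (√(√(lam i)))⁻¹ * (√(√(lam i)))⁻¹) M := fun i x => by
    rw [h.diag]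
    beta_reduce
    rw [← mul_inv, Real.mul_self_sqrt (Real.sqrt_nonneg _)]
  rw [h1, ← real_inner_self_eq_norm_sq, hD.symm, hD.comp_apply hD hDD, real_inner_comm]

theorem opPow_neg_half (h : IsEigenSystem A l b lam M) (g : H) :
    opPow A (-(1 / 2)) g = M g :=
  (h.isBeamOperator.opPow_eq h.mem fun i => by
    rw [h.diag, Real.rpow_neg (h.lam_pos i).le, ← Real.sqrt_eq_rpow]).2

theorem phaseSpace_ext (h : IsEigenSystem A l b lam M) {z z' : PhaseSpace A}
    (h1 : sqrtMap A z.disp = sqrtMap A z'.disp) (h2 : z.vel = z'.vel) (h3 : z.temp = z'.temp) :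
    z = z' := by
  have h1' := h.sqrtMap_injective h1
  refine (WithLp.ofLp_injective 2) (Prod.ext h1' ((WithLp.ofLp_injective 2) (Prod.ext h2 h3)))

/-- The phase space is only declared seminormed; injectivity of A^(1/2) is what makes it separated.
-/
theorem eq_of_norm_sub_eq_zero (h : IsEigenSystem A l b lam M) {z z' : PhaseSpace A}
    (hz : ‖z - z'‖ = 0) : z = z' := by
  have h0 := norm_sq_phaseSpace (z - z')
  rw [hz] at h0
  simp only [triSq] at h0
  have p1 := sq_nonneg ‖sqrtMap A (z - z').disp‖
  have p2 := sq_nonneg ‖(z - z').vel‖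
  have p3 := sq_nonneg ‖(z - z').temp‖
  have e1 : sqrtMap A (z - z').disp = 0 := by
    rw [← norm_eq_zero, ← sq_eq_zero_iff]; linarith
  have e2 : (z - z').vel = 0 := by
    rw [← norm_eq_zero, ← sq_eq_zero_iff]; linarith
  have e3 : (z - z').temp = 0 := by
    rw [← norm_eq_zero, ← sq_eq_zero_iff]; linarith
  refine h.phaseSpace_ext ?_ (sub_eq_zero.1 e2) (sub_eq_zero.1 e3)
  have : sqrtMap A (z - z').disp = sqrtMap A z.disp - sqrtMap A z'.disp := map_sub _ _ _
  rwa [this, sub_eq_zero] at e1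

/-- The distance to the stationary state in coordinates. -/
theorem norm_sub_zState_sq (h : IsEigenSystem A l b lam M) (z : PhaseSpace A) (g : H) :
    ‖z - zState A g‖ ^ 2 = triSq (sqrtMap A z.disp) z.vel (z.temp - M g) := by
  rw [norm_sq_phaseSpace, ← h.opPow_neg_half]
  have e1 : sqrtMap A (z - zState A g).disp = sqrtMap A z.disp := by
    have : (z - zState A g).disp = z.disp - 0 := rfl
    rw [this, sub_zero]
  have e2 : (z - zState A g).vel = z.vel := sub_zero _
  rw [e1, e2]
  rfl

theorem norm_zState_le (h : IsEigenSystem A l b lam M) (g : H) : ‖zState A g‖ ≤ ‖g‖ / l := by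
  have h1 : ‖zState A g‖ ^ 2 = ‖M g‖ ^ 2 := by
    rw [norm_sq_phaseSpace, ← h.opPow_neg_half]
    have e1 : sqrtMap A (zState A g).disp = 0 := map_zero _
    have e2 : (zState A g).vel = 0 := rfl
    rw [e1, e2]
    simp only [triSq, norm_zero]
    rw [zero_pow two_ne_zero, zero_add, zero_add]
    rfl
  rw [(sq_eq_sq₀ (norm_nonneg _) (norm_nonneg _)).1 h1, div_eq_inv_mul]
  exact h.norm_le g

variable {β : ℝ} {f g : H}

/-- Weak solutions solve the beam system mode by mode. -/
theorem isModeSolution (h : IsEigenSystem A l b lam M) (hfg : f + g = 0) {z : PhaseSpace A}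
    {U : ℝ → PhaseSpace A} (hU : IsWeakSolution A β f g z U) :
    IsModeSolution b (fun i => √(lam i)) M β (fun t => sqrtMap A (U t).disp)
      (fun t => (U t).vel) (fun t => (U t).temp - M g) := by
  have hf : f = -g := eq_neg_of_add_eq_zero_left hfg
  have htest : ∀ i, ∃ φ : SpaceH2 A, φ.val = b i ∧ sqrtMap A φ = √(lam i) • b i := fun i => by
    obtain ⟨φ, h1, h2⟩ := h.exists_sqrtMap_eq (√(lam i) • b i)
    refine ⟨φ, ?_, h2⟩
    rw [h1, map_smul, h.diag.apply_basis, smul_smul, mul_inv_cancel₀ (h.sqrt_pos i).ne', one_smul]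
  -- This identity cancels the sources: shifting the temperature by `M g` removes `g` from the heat
  -- equation and turns the momentum source into f + g = 0.
  have hMg : ∀ i, √(lam i) * inner ℝ (b i) (M g) = inner ℝ (b i) g := fun i => by
    rw [h.diag, mul_inv_cancel_left₀ (h.sqrt_pos i).ne']
  refine ⟨(isometry_sqrtMap.continuous.comp continuous_disp).comp_continuousOn hU.continuousOn,
    continuous_vel.comp_continuousOn hU.continuousOn,
    (continuous_temp.comp_continuousOn hU.continuousOn).sub continuousOn_const,
    fun i t ht => ?_, fun i t ht => ?_, fun i t ht => ?_⟩
  · have h1 := ((innerSL ℝ (b i)).hasFDerivAt.comp_hasDerivWithinAt t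
      (hU.velocity t ht)).const_mul √(lam i)
    have e : ∀ s, inner ℝ (b i) (sqrtMap A (U s).disp) =
        √(lam i) * inner ℝ (b i) (U s).disp.val := fun s => by
      rw [h.val_eq, h.diag, mul_inv_cancel_left₀ (h.sqrt_pos i).ne']
    simp only [e]
    exact h1
  · obtain ⟨φ, hφ1, hφ2⟩ := htest i
    have h1 := hU.momentum φ t ht
    rw [hφ1, hφ2] at h1
    simp only [real_inner_comm (b i)] at h1
    refine h1.congr_deriv ?_
    rw [h.norm_quarter_sq, hf]
    simp only [force, inner_smul_right, inner_neg_right, inner_sub_right, mul_sub, hMg,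
      real_inner_comm (b i)]
    ring
  · obtain ⟨φ, hφ1, hφ2⟩ := htest i
    have h1 := (hU.heat φ t ht).sub_const (inner ℝ (b i) (M g))
    rw [hφ1, hφ2] at h1
    simp only [real_inner_comm (b i)] at h1
    simp only [inner_sub_right]
    refine h1.congr_deriv ?_
    simp only [inner_smul_right, mul_sub, hMg, real_inner_comm (b i)]
    ring

/-- Strong solutions give weak solutions. -/
theorem exists_isWeakSolution (h : IsEigenSystem A l b lam M) (hfg : f + g = 0)
    {z : PhaseSpace A} {x v w : ℝ → H} (hx : x 0 = sqrtMap A z.disp) (hv : v 0 = z.vel)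
    (hw : w 0 = z.temp - M g) (hS : IsStrongSolution M β x v w) :
    ∃ U, IsWeakSolution A β f g z U ∧ ∀ t, sqrtMap A (U t).disp = x t ∧ (U t).vel = v t ∧
      (U t).temp - M g = w t := by
  have hf : f = -g := eq_neg_of_add_eq_zero_left hfg
  choose y hy1 hy2 using fun t => h.exists_sqrtMap_eq (x t)
  have hsymm : ∀ a c, inner ℝ (M a) c = inner ℝ a (M c) := h.diag.symm
  refine ⟨fun t => PhaseSpace.mk (y t) (v t) (w t + M g), ⟨?_, ?_, fun t ht => ?_,
    fun φ t ht => ?_, fun φ t ht => ?_⟩, fun t => ⟨hy2 t, rfl, add_sub_cancel_right _ _⟩⟩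
  · refine continuousOn_mk ?_ hS.contV (hS.contW.add continuousOn_const)
    simp only [hy2]
    exact hS.contX
  · refine h.phaseSpace_ext ((hy2 0).trans hx) hv ?_
    change w 0 + M g = z.temp
    rw [hw, sub_add_cancel]
  · have e : (fun s => (PhaseSpace.mk (y s) (v s) (w s + M g)).disp.val) = fun s => M (x s) :=
      funext hy1
    rw [e]
    exact hS.derivX t ht
  · change HasDerivWithinAt (fun s => inner ℝ (v s) φ.val)
      (inner ℝ f φ.val - inner ℝ (sqrtMap A (y t)) (sqrtMap A φ) +
        inner ℝ (w t + M g) (sqrtMap A φ) -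
        (β + ‖opPow A (1 / 4) (y t).val‖ ^ 2) * inner ℝ (sqrtMap A (y t)) φ.val) (Ici 0) t
    have h1 := (hS.derivV t ht).inner ℝ (hasDerivWithinAt_const t (Ici 0) (sqrtMap A φ))
    -- Only `M (v s)` is known to be differentiable; writing φ = M A^(1/2) φ moves `M` from the test
    -- function to the solution.
    have e : ∀ s, inner ℝ (v s) φ.val = inner ℝ (M (v s)) (sqrtMap A φ) := fun s => by
      rw [h.val_eq, hsymm]
    simp only [e]
    refine h1.congr_deriv ?_
    rw [h.norm_quarter_sq, hy2, hf, h.val_eq φ]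
    simp only [force, map_zero, inner_zero_right, inner_sub_left, inner_add_left, inner_neg_left, map_smul,
      real_inner_smul_left, hsymm]
    ring
  · change HasDerivWithinAt (fun s => inner ℝ (w s + M g) φ.val)
      (inner ℝ g φ.val - inner ℝ (w t + M g) (sqrtMap A φ) - inner ℝ (v t) (sqrtMap A φ))
      (Ici 0) t
    have h1 := ((hS.derivW t ht).inner ℝ
      (hasDerivWithinAt_const t (Ici 0) (sqrtMap A φ))).add_const (inner ℝ (M g) φ.val)
    have e : ∀ s, inner ℝ (w s + M g) φ.val =
        inner ℝ (M (w s)) (sqrtMap A φ) + inner ℝ (M g) φ.val := fun s => by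
      rw [inner_add_left, hsymm (w s), ← h.val_eq]
    simp only [e]
    refine h1.congr_deriv ?_
    rw [h.val_eq φ]
    simp only [map_zero, inner_zero_right, inner_sub_left, inner_add_left, inner_neg_left, hsymm]
    ring

/-- Weak solutions exist and decay to the stationary state. -/
theorem exists_weakSolution (h : IsEigenSystem A l b lam M) (hβ : -l < β) (hfg : f + g = 0)
    (z : PhaseSpace A) : ∃ U, IsWeakSolution A β f g z U ∧ ∀ t, 0 ≤ t →
      ‖U t - zState A g‖ ^ 2 ≤ sqBound β l (‖z - zState A g‖ ^ 2) * Real.exp (-sqRate β l * t) := by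
  obtain ⟨x, v, w, hx, hv, hw, hS, hdec⟩ := exists_strongSolution b h.pos hβ h.le h.diag
    (sqrtMap A z.disp) z.vel (z.temp - M g)
  obtain ⟨U, hU, hUt⟩ := h.exists_isWeakSolution hfg hx hv hw hS
  refine ⟨U, hU, fun t ht => ?_⟩
  rw [h.norm_sub_zState_sq, h.norm_sub_zState_sq, (hUt t).1, (hUt t).2.1, (hUt t).2.2]
  exact hdec t ht

/-- Weak solutions are unique. -/
theorem weakSolution_unique (h : IsEigenSystem A l b lam M) (hfg : f + g = 0)
    {z : PhaseSpace A} {U U' : ℝ → PhaseSpace A} (hU : IsWeakSolution A β f g z U)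
    (hU' : IsWeakSolution A β f g z U') {t : ℝ} (ht : 0 ≤ t) : U t = U' t := by
  obtain ⟨h1, h2, h3⟩ := (h.isModeSolution hfg hU).unique h.pos (fun i => Real.sqrt_nonneg _)
    h.norm_le (h.isModeSolution hfg hU') (by rw [hU.initial, hU'.initial])
    (by rw [hU.initial, hU'.initial]) (by rw [hU.initial, hU'.initial]) ht
  exact h.phaseSpace_ext h1 h2 (sub_left_injective h3)

end IsEigenSystem

end Coordinates

-- The rate and the prefactor in the original parameters

/-- The decay rate as a formula in `(β, λ₁)`. -/
def rateFormula : Formula 2 :=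
  .mul (.const (1 / 2)) (.sqRate (.var 0) (.sqrt (.var 1)))

/-- The radius `1 + R + ‖g‖ / √λ₁` as a formula in `(β, λ₁, ‖g‖, R)`. -/
def radiusFormula : Formula 4 :=
  .add (.add (.const 1) (.var 3)) (.div (.var 2) (.sqrt (.var 1)))

/-- The prefactor of the exponential estimate as a formula in `(β, λ₁, ‖g‖, R)`. -/
def prefactorFormula : Formula 4 :=
  .sqrt (.sqBound (.var 0) (.sqrt (.var 1)) (.mul radiusFormula radiusFormula))

theorem eval_rateFormula (β μ : ℝ) :
    rateFormula.eval ![β, μ] = sqRate β √μ / 2 := by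
  simp only [rateFormula, Formula.eval, Formula.eval_sqRate, Matrix.cons_val_zero,
    Matrix.cons_val_one]
  push_cast
  ring

theorem eval_prefactorFormula (β μ γ R : ℝ) :
    prefactorFormula.eval ![β, μ, γ, R] = √(sqBound β √μ ((1 + R + γ / √μ) ^ 2)) := by
  simp [prefactorFormula, radiusFormula, Formula.eval, Formula.eval_sqBound, Formula.eval_div, sq]

theorem sqBound_radius_lt {β l γ R R' : ℝ} (hl : 0 < l) (hβ : -l < β) (hγ : 0 ≤ γ) (hR : 0 ≤ R)
    (h : R < R') : sqBound β l ((1 + R + γ / l) ^ 2) < sqBound β l ((1 + R' + γ / l) ^ 2) := by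
  have h0 : 0 ≤ γ / l := div_nonneg hγ hl.le
  refine sqBound_strictMonoOn hl hβ (mem_Ici.2 (sq_nonneg _)) (mem_Ici.2 (sq_nonneg _)) ?_
  exact pow_lt_pow_left₀ (by linarith) (by linarith) two_ne_zero

/-- The summand 1 in the radius is there for this: it keeps the prefactor positive even if `R` and
`γ` vanish. -/
theorem sqBound_radius_pos {β l γ R : ℝ} (hl : 0 < l) (hβ : -l < β) (hγ : 0 ≤ γ) (hR : 0 ≤ R) :
    0 < sqBound β l ((1 + R + γ / l) ^ 2) := by
  have h0 : 0 ≤ γ / l := div_nonneg hγ hl.le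
  refine (sqBound_nonneg hl hβ le_rfl).trans_lt
    (sqBound_strictMonoOn hl hβ (mem_Ici.2 le_rfl) (mem_Ici.2 (sq_nonneg _)) ?_)
  have : 0 < 1 + R + γ / l := by linarith
  positivity

theorem sqBound_zero (β l : ℝ) : sqBound β l 0 = 0 := by simp [sqBound, energyBound]

-- Bounded sets and one-point attractors

section SemigroupEstimates

variable {X : Type*} [SeminormedAddCommGroup X]

theorem norm_le_setNorm {B : Set X} (hB : Bornology.IsBounded B) {z : X} (hz : z ∈ B) :
    ‖z‖ ≤ setNorm B := by
  obtain ⟨C, hC⟩ := hB.exists_norm_le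
  exact le_ciSup (f := fun z : B => ‖(z : X)‖) ⟨C, by rintro _ ⟨y, rfl⟩; exact hC y y.2⟩ ⟨z, hz⟩

theorem semidist_image_singleton (S : X → X) (B : Set X) (y : X) :
    semidist (S '' B) {y} = ⨆ z ∈ B, ‖S z - y‖ₑ := by
  unfold semidist
  rw [iSup_image]
  simp only [Metric.infEDist_singleton, edist_eq_enorm_sub]

end SemigroupEstimates

section Semigroup

variable {X : Type u} [SeminormedAddCommGroup X]

/-- A semigroup with a stationary state that attracts all bounded sets uniformly has exactly one
global attractor. -/
theorem isGlobalAttractor_iff_eq_singleton {S : ℝ → X → X} {y : X}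
    (hsep : ∀ z, ‖z - y‖ = 0 → z = y) (hy : ∀ t, 0 ≤ t → S t y = y)
    (hattr : ∀ B : Set X, Bornology.IsBounded B →
      Tendsto (fun t => ⨆ z ∈ B, ‖S t z - y‖ₑ) atTop (𝓝 0)) (K : Set X) :
    IsGlobalAttractor S K ↔ K = {y} := by
  constructor
  · intro hK
    -- By invariance each point of `K` is S(t) of a point of `K` for every t ≥ 0, and `K` is
    -- bounded, so its distance to `y` is below a quantity tending to 0.
    have hsub : K ⊆ {y} := by
      intro z hz
      have hle : ∀ᶠ t in atTop, ‖z - y‖ₑ ≤ ⨆ z ∈ K, ‖S t z - y‖ₑ := by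
        filter_upwards [eventually_ge_atTop 0] with t ht
        obtain ⟨z', hz', rfl⟩ := (hK.invariant t ht).symm ▸ hz
        exact le_iSup₂ (f := fun z (_ : z ∈ K) => ‖S t z - y‖ₑ) z' hz'
      have h0 := ge_of_tendsto (hattr K hK.compact.isBounded) hle
      refine hsep z ?_
      rw [← toReal_enorm, nonpos_iff_eq_zero.1 h0, ENNReal.toReal_zero]
    refine subset_antisymm hsub (singleton_subset_iff.2 ?_)
    by_contra hyK
    have hempty : K = ∅ := by
      rw [eq_empty_iff_forall_notMem]
      intro z hz
      exact hyK (hsub hz ▸ hz)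
    -- The empty set is compact and invariant, but it attracts nothing: the distance to it is `⊤`.
    have h1 := hK.attracting {y} Bornology.isBounded_singleton
    have h2 : Tendsto (fun _ : ℝ => (⊤ : ℝ≥0∞)) atTop (𝓝 0) := by
      refine h1.congr' ?_
      filter_upwards with t
      simp [semidist, hempty]
    exact ENNReal.top_ne_zero (tendsto_nhds_unique tendsto_const_nhds h2)
  · rintro rfl
    refine ⟨isCompact_singleton, fun t ht => by rw [image_singleton, hy t ht], fun B hB => ?_⟩
    simp only [semidist_image_singleton]
    exact hattr B hB

end Semigroup

end ThermoBeam

-- Proof of the theorem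

theorem corollary4p5 :
    ∃ (kappa : ThermoBeam.Formula 2) (Q : ThermoBeam.Formula 4),
      ∀ (H : Type u) [NormedAddCommGroup H] [InnerProductSpace ℝ H] [CompleteSpace H]
        [TopologicalSpace.SeparableSpace H] [Nontrivial H]
        (A : H →ₗ.[ℝ] H), ThermoBeam.IsBeamOperator A →
      ∀ (β : ℝ) (f g : H), -Real.sqrt (ThermoBeam.firstEigenvalue A) < β → f + g = 0 →
        -- the solution operators are well defined on the whole phase space
        (∀ z : ThermoBeam.PhaseSpace A,
          ThermoBeam.IsWeakSolution A β f g z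
            (fun t => ThermoBeam.solutionOp A β f g t z) ∧
          ∀ U : ℝ → ThermoBeam.PhaseSpace A, ThermoBeam.IsWeakSolution A β f g z U →
            ∀ t : ℝ, 0 ≤ t → U t = ThermoBeam.solutionOp A β f g t z) ∧
        -- the global attractor exists, is unique, and is the single state `z_g`
        (∀ K : Set (ThermoBeam.PhaseSpace A),
          ThermoBeam.IsGlobalAttractor (ThermoBeam.solutionOp A β f g) K ↔
            K = {ThermoBeam.zState A g}) ∧
        -- exponential attraction of bounded sets
        0 < kappa.eval ![β, ThermoBeam.firstEigenvalue A] ∧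
        (∀ R : ℝ, 0 ≤ R → 0 < Q.eval ![β, ThermoBeam.firstEigenvalue A, ‖g‖, R]) ∧
        StrictMonoOn (fun R : ℝ => Q.eval ![β, ThermoBeam.firstEigenvalue A, ‖g‖, R])
          (Set.Ici 0) ∧
        ∀ B : Set (ThermoBeam.PhaseSpace A), Bornology.IsBounded B → ∀ t : ℝ, 0 ≤ t →
          ThermoBeam.semidist (ThermoBeam.solutionOp A β f g t '' B) {ThermoBeam.zState A g} =
            (⨆ z ∈ B, ‖ThermoBeam.solutionOp A β f g t z - ThermoBeam.zState A g‖ₑ) ∧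
          (⨆ z ∈ B, ‖ThermoBeam.solutionOp A β f g t z - ThermoBeam.zState A g‖ₑ) ≤
            ENNReal.ofReal
              (Q.eval ![β, ThermoBeam.firstEigenvalue A, ‖g‖, ThermoBeam.setNorm B] *
                Real.exp (-kappa.eval ![β, ThermoBeam.firstEigenvalue A] * t)) := by
  refine ⟨ThermoBeam.rateFormula, ThermoBeam.prefactorFormula, ?_⟩
  intro H _ _ _ _ _ A hA β f g hβ hfg
  obtain ⟨ι, b, lam, M, h⟩ := hA.exists_isEigenSystem
  simp only [ThermoBeam.eval_rateFormula, ThermoBeam.eval_prefactorFormula]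
  set l := Real.sqrt (ThermoBeam.firstEigenvalue A)
  set S := ThermoBeam.solutionOp A β f g with hS
  set y := ThermoBeam.zState A g
  have hl := h.pos
  have hsol : ∀ z, ThermoBeam.IsWeakSolution A β f g z (fun t => S t z) := fun z => by
    obtain ⟨U, hU, -⟩ := h.exists_weakSolution hβ hfg z
    have hex : ∃ U, ThermoBeam.IsWeakSolution A β f g z U := ⟨U, hU⟩
    have : (fun t => S t z) = hex.choose := funext fun t => by
      rw [hS, ThermoBeam.solutionOp, dif_pos hex]
    rw [this]
    exact hex.choose_spec
  -- The solution chosen by `solutionOp` is arbitrary; uniqueness identifies it with the one for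
  -- which decay was proved.
  have hdec : ∀ z t, 0 ≤ t → ‖S t z - y‖ ^ 2 ≤
      ThermoBeam.sqBound β l (‖z - y‖ ^ 2) * Real.exp (-ThermoBeam.sqRate β l * t) :=
    fun z t ht => by
      obtain ⟨U, hU, hUd⟩ := h.exists_weakSolution hβ hfg z
      rw [h.weakSolution_unique hfg (hsol z) hU ht]
      exact hUd t ht
  have hbound : ∀ B : Set (ThermoBeam.PhaseSpace A), Bornology.IsBounded B → ∀ t : ℝ, 0 ≤ t →
      (⨆ z ∈ B, ‖S t z - y‖ₑ) ≤ ENNReal.ofReal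
        (√(ThermoBeam.sqBound β l ((1 + ThermoBeam.setNorm B + ‖g‖ / l) ^ 2)) *
          Real.exp (-(ThermoBeam.sqRate β l / 2) * t)) := by
    intro B hB t ht
    refine iSup₂_le fun z hz => ?_
    rw [← ofReal_norm]
    refine ENNReal.ofReal_le_ofReal ?_
    have hzy : ‖z - y‖ ≤ 1 + ThermoBeam.setNorm B + ‖g‖ / l := by
      have h1 := norm_sub_le z y
      have h2 := ThermoBeam.norm_le_setNorm hB hz
      have h3 := h.norm_zState_le g
      linarith
    have h4 : ThermoBeam.sqBound β l (‖z - y‖ ^ 2) ≤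
        ThermoBeam.sqBound β l ((1 + ThermoBeam.setNorm B + ‖g‖ / l) ^ 2) :=
      (ThermoBeam.sqBound_strictMonoOn hl hβ).monotoneOn (Set.mem_Ici.2 (sq_nonneg _))
        (Set.mem_Ici.2 (sq_nonneg _)) (pow_le_pow_left₀ (norm_nonneg _) hzy 2)
    have h5 := (hdec z t ht).trans (mul_le_mul_of_nonneg_right h4 (Real.exp_pos _).le)
    have h6 : Real.exp (-ThermoBeam.sqRate β l * t) =
        Real.exp (-(ThermoBeam.sqRate β l / 2) * t) ^ 2 := by
      rw [← Real.exp_nat_mul]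
      congr 1
      push_cast
      ring
    rw [h6] at h5
    refine (Real.le_sqrt_of_sq_le h5).trans_eq ?_
    rw [Real.sqrt_mul (ThermoBeam.sqBound_nonneg hl hβ (sq_nonneg _)),
      Real.sqrt_sq (Real.exp_pos _).le]
  have hrate := ThermoBeam.sqRate_pos hl hβ
  refine ⟨fun z => ⟨hsol z, fun U hU t ht => h.weakSolution_unique hfg hU (hsol z) ht⟩,
    ThermoBeam.isGlobalAttractor_iff_eq_singleton (fun z hz => h.eq_of_norm_sub_eq_zero hz)
      (fun t ht => h.eq_of_norm_sub_eq_zero ?_) (fun B hB => ?_), by positivity,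
    fun R hR => Real.sqrt_pos.2 (ThermoBeam.sqBound_radius_pos hl hβ (norm_nonneg g) hR),
    fun R hR R' _ hRR' => ?_, fun B hB t ht =>
      ⟨ThermoBeam.semidist_image_singleton _ _ _, hbound B hB t ht⟩⟩
  -- Stationarity of `y` needs no computation: the decay estimate started at `y` has prefactor
  -- `sqBound β l 0 = 0`.
  · have h1 := hdec y t ht
    rw [sub_self, norm_zero, zero_pow two_ne_zero, ThermoBeam.sqBound_zero, zero_mul] at h1
    exact pow_eq_zero_iff two_ne_zero |>.1 (le_antisymm h1 (sq_nonneg _))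
  · have h1 : Tendsto (fun t : ℝ => ENNReal.ofReal
        (√(ThermoBeam.sqBound β l ((1 + ThermoBeam.setNorm B + ‖g‖ / l) ^ 2)) *
          Real.exp (-(ThermoBeam.sqRate β l / 2) * t))) atTop (𝓝 0) := by
      have h2 : Tendsto (fun t : ℝ => -(ThermoBeam.sqRate β l / 2) * t) atTop atBot :=
        tendsto_id.const_mul_atTop_of_neg (by linarith)
      have h3 := (Real.tendsto_exp_atBot.comp h2).const_mul
        √(ThermoBeam.sqBound β l ((1 + ThermoBeam.setNorm B + ‖g‖ / l) ^ 2))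
      rw [mul_zero] at h3
      simpa using ENNReal.tendsto_ofReal h3
    refine tendsto_of_tendsto_of_tendsto_of_le_of_le' tendsto_const_nhds h1
      (Eventually.of_forall fun _ => zero_le) ?_
    filter_upwards [eventually_ge_atTop 0] with t ht
    exact hbound B hB t ht
  · exact Real.sqrt_lt_sqrt (ThermoBeam.sqBound_radius_pos hl hβ (norm_nonneg g) hR).le
      (ThermoBeam.sqBound_radius_lt hl hβ (norm_nonneg g) hR hRR')
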